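/- \textbf{Setting.} Let $I=(0,1]$ and let $\rho=(\rho_\varepsilon)_{\varepsilon\in I}$ be a gauge, i.e. a net in $(0,1]$ with $\rho_\varepsilon\to0$ as $\varepsilon\to0^+$. Let ${}^\rho\widetilde{\mathbb R}$, ${}^\rho\widetilde{\mathbb C}$ be the rings of $\rho$-moderate real, complex nets ($x_\varepsilon=O(\rho_\varepsilon^{-N})$ for some $N\in\mathbb N$) modulo $\rho$-negligible ones ($x_\varepsilon=O(\rho_\varepsilon^{N})$ for all $N\in\mathbb N$); $[x_\varepsilon]$ is the class of $(x_\varepsilon)$, $|[z_\varepsilon]|=[|z_\varepsilon|]$, and $\mathbb C\subseteq{}^\rho\widetilde{\mathbb C}$ via constant nets. Here $x\le y$ means that every representative $(x_\varepsilon)$ of $x$ admits a representative $(y_\varepsilon)$ of $y$ with $x_\varepsilon\le y_\varepsilon$ for $\varepsilon$ small, and $x<y$ that $x\le y$ and $x-y$ is invertible. The sharp topology is generated by the balls $B_r(z)=\{w:|w-z|<r\}$, $0<r\in{}^\rho\widetilde{\mathbb R}$. Put $\mathrm d\rho^q=[\rho_\varepsilon^q]$. For $A_\varepsilon\subseteq\mathbb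 C$ let $\langle A_\varepsilon\rangle$ be the set of $z$ all of whose representatives satisfy $z_\varepsilon\in A_\varepsilon$ for $\varepsilon$ small. A map $F:U\to{}^\rho\widetilde{\mathbb C}$ is a basic function defined by the net $f_\varepsilon:A_\varepsilon\to\mathbb C$ if $U\subseteq\langle A_\varepsilon\rangle$ and $F(z)=[f_\varepsilon(z_\varepsilon)]$ for all $z\in U$ and all representatives $(z_\varepsilon)$ of $z$; basic functions of two variables are defined analogously. A map $F:U\to{}^\rho\widetilde{\mathbb C}$ on a nonempty sharply open set $U$ is a \emph{generalized holomorphic function} (GHF) if it is defined by a net of holomorphic functions $f_\varepsilon:A_\varepsilon\to\mathbb C$, $A_\varepsilon$ open, and there are a set $U_0\subseteq{}^\rho\widetilde{\mathbb C}$ and a net $(r_\varepsilon)$ defining a basic function $r$ on $\{(z,h): z\in U,\ h\in U_0,\ z+h\in U\}$ such that for all $z\in U$: $U_0\cap(U-z)$ contains a sharp ball around $0$; $\lim_{h\to0}r(z,h)=0$ in the sharp topology; and there is $F'(z)\in{}^\rho\widetilde{\mathbb C}$ such that each representative $(z_\varepsilon)$ of $z$ admits a representative $(m_\varepsilon)$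 of $F'(z)$ with the property that, for every $h\in U_0\cap(U-z)$ and every representative $(h_\varepsilon)$ of $h$, for $\varepsilon$ small, $f_\varepsilon(z_\varepsilon+h_\varepsilon)=f_\varepsilon(z_\varepsilon)+h_\varepsilon m_\varepsilon+h_\varepsilon r_\varepsilon(z_\varepsilon,h_\varepsilon)$ and $r_\varepsilon(z_\varepsilon,0)=0=\lim_{t\to0}r_\varepsilon(z_\varepsilon,t)$. The generalized partial derivatives $\partial_1F$, $\partial_2F$ (with respect to $x$, $y$, where $z=x+iy$) are defined in the same way, with real increments $h$, with $z+h$ replaced by $z+ih$ in the case of $\partial_2$, and with $f_\varepsilon$ partially differentiable on $A_\varepsilon$ instead of holomorphic; $\partial^\alpha F$ is obtained by iteration. \textbf{Theorem.} Let $\Omega\subseteq\mathbb C$ be open, $k\in\mathcal D(\Omega)$ (complex valued) with $\int_{\mathbb R^2}k=1$, and $k_\varepsilon(z):=\rho_\varepsilon^{-2}k(\rho_\varepsilon^{-1}z)$. For $f\in L^1_{\mathrm{loc}}(\Omega)$ let $(f*k_\varepsilon)(z)=\int_\Omega f(\zeta)k_\varepsilon(z-\zeta)\,\mathrm d\zeta$,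 which is defined at the points $z\in\Omega$ with $z-\operatorname{supp}k_\varepsilon\subseteq\Omega$. Let $d_f$ be the set of all $z=[z_\varepsilon]\in{}^\rho\widetilde{\mathbb C}$ such that for some real $q>0$: $B_{\mathrm d\rho^q}(z)\subseteq\langle\Omega\rangle$; for $\varepsilon$ small, $f*k_\varepsilon$ is defined and holomorphic on the Euclidean ball of radius $\rho_\varepsilon^q$ at $z_\varepsilon$; the net $(f*k_\varepsilon)$ defines a basic function on $B_{\mathrm d\rho^q}(z)$; and $((f*k_\varepsilon)'(c_\varepsilon))$ is $\rho$-moderate for every representative $(c_\varepsilon)$ of every point of $B_{\mathrm d\rho^q}(z)$. Let $\jmath(f):[z_\varepsilon]\in d_f\mapsto[(f*k_\varepsilon)(z_\varepsilon)]\in{}^\rho\widetilde{\mathbb C}$. Suppose that $f\in L^1_{\mathrm{loc}}(\Omega)$ satisfies the Cauchy--Riemann equations in the sense of distributions, i.e. $\int_\Omega f\,(\partial_1\varphi+i\,\partial_2\varphi)=0$ for all $\varphi\in\mathcal D(\Omega)$. Then: \begin{enumerate} \item[(a)] $\jmath(f)$ is well defined (independent of representatives), is a GHF on $d_f$, and $\Omega\subseteq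 d_f$. \item[(b)] $\jmath$ preserves weak derivatives: if $g\in L^1_{\mathrm{loc}}(\Omega)$ is the weak derivative $\partial^\alpha f$, $\alpha\in\mathbb N^2$, then $d_f\subseteq d_g$ and $\jmath(\partial^\alpha f)=\partial^\alpha\jmath(f)$ on $d_f$. \item[(c)] If $g\in L^1_{\mathrm{loc}}(\Omega)$ also satisfies the Cauchy--Riemann equations in the sense of distributions, then $\jmath(f)=\jmath(g)$ (same domain and same values) if and only if $f=g$ almost everywhere on $\Omega$. \item[(d)] If $f$ is continuous on $\Omega$, then $f$ is holomorphic on $\Omega$, and for every $z\in\Omega$ the number $\jmath(f)(z)$ has the standard part $f(z)$, i.e. it has a representative converging to $f(z)$ as $\varepsilon\to0^+$. \item[(e)] If $f$ is continuous on $\Omega$ and $\jmath(f)(z)\in\mathbb C$ for all $z\in\Omega$, then $\jmath(f)(z)=f(z)$ for all $z\in\Omega$. \end{enumerate} -/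

import Mathlib

open Filter Topology MeasureTheory TopologicalSpace
open scoped Distributions LineDeriv

noncomputable section

namespace GHF

/-! ## Gauges, moderate and negligible nets, generalized numbers -/

/-- The index set `I = (0,1]`. -/
abbrev Idx : Type := Set.Ioc (0 : ℝ) 1

/-- The filter `ε → 0⁺` on `I`; `∀ᶠ ε in small, P ε` reads "for `ε` small". -/
def small : Filter Idx := comap Subtype.val (𝓝 (0 : ℝ))

/-- A gauge: a net `ρ : (0,1] → (0,1]` with `ρ_ε → 0` as `ε → 0⁺`. -/
structure Gauge where
  val : Idx → ℝ
  pos : ∀ ε, 0 < val ε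
  le_one : ∀ ε, val ε ≤ 1
  tendsto : Tendsto val small (𝓝 0)

instance : CoeFun Gauge (fun _ => Idx → ℝ) := ⟨Gauge.val⟩

/-- `x_ε = O(ρ_ε^{-N})` for some `N`. -/
def IsModerate (ρ : Gauge) {𝕜 : Type*} [RCLike 𝕜] (x : Idx → 𝕜) : Prop :=
  ∃ N : ℕ, x =O[small] fun ε => (ρ ε ^ N)⁻¹

/-- `x_ε = O(ρ_ε^N)` for every `N`. -/
def IsNegligible (ρ : Gauge) {𝕜 : Type*} [RCLike 𝕜] (x : Idx → 𝕜) : Prop :=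
  ∀ N : ℕ, x =O[small] fun ε => ρ ε ^ N

theorem inv_pow_bigO (ρ : Gauge) {M N : ℕ} (h : M ≤ N) :
    (fun ε => (ρ ε ^ M)⁻¹) =O[small] fun ε => (ρ ε ^ N)⁻¹ := by
  refine Asymptotics.IsBigO.of_bound 1 (Eventually.of_forall fun ε => ?_)
  have hp := ρ.pos ε
  rw [one_mul, Real.norm_of_nonneg (by positivity), Real.norm_of_nonneg (by positivity)]
  exact inv_anti₀ (by positivity) (pow_le_pow_of_le_one hp.le (ρ.le_one ε) h)

theorem IsModerate.add {ρ : Gauge} {𝕜 : Type*} [RCLike 𝕜] {x y : Idx → 𝕜}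
    (hx : IsModerate ρ x) (hy : IsModerate ρ y) : IsModerate ρ (x + y) := by
  obtain ⟨M, hM⟩ := hx
  obtain ⟨N, hN⟩ := hy
  exact ⟨max M N, (hM.trans (inv_pow_bigO ρ (le_max_left M N))).add
    (hN.trans (inv_pow_bigO ρ (le_max_right M N)))⟩

theorem IsModerate.mul {ρ : Gauge} {𝕜 : Type*} [RCLike 𝕜] {x y : Idx → 𝕜}
    (hx : IsModerate ρ x) (hy : IsModerate ρ y) : IsModerate ρ (x * y) := by
  obtain ⟨M, hM⟩ := hx
  obtain ⟨N, hN⟩ := hy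
  refine ⟨M + N, (hM.mul hN).congr_right fun ε => ?_⟩
  rw [pow_add, mul_inv]

theorem isModerate_const (ρ : Gauge) {𝕜 : Type*} [RCLike 𝕜] (c : 𝕜) :
    IsModerate ρ (fun _ => c) := by
  refine ⟨0, ?_⟩
  simpa using Asymptotics.isBigO_const_const c (one_ne_zero : (1 : ℝ) ≠ 0) small

/-- The ring of `ρ`-moderate nets. -/
def moderateNets (ρ : Gauge) (𝕜 : Type) [RCLike 𝕜] : Subring (Idx → 𝕜) where
  carrier := {x | IsModerate ρ x}
  mul_mem' := IsModerate.mul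
  one_mem' := isModerate_const ρ 1
  add_mem' := IsModerate.add
  zero_mem' := isModerate_const ρ 0
  neg_mem' := by
    rintro x ⟨N, hN⟩
    exact ⟨N, hN.neg_left⟩

/-- The ideal of `ρ`-negligible nets. -/
def negligibleNets (ρ : Gauge) (𝕜 : Type) [RCLike 𝕜] : Ideal (moderateNets ρ 𝕜) where
  carrier := {x | IsNegligible ρ (x : Idx → 𝕜)}
  add_mem' := fun hx hy N => (hx N).add (hy N)
  zero_mem' := fun N => Asymptotics.isBigO_zero _ _
  smul_mem' := by
    rintro ⟨c, M, hM⟩ x hx N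
    refine (hM.mul (hx (M + N))).congr_right fun ε => ?_
    have := (pow_pos (ρ.pos ε) M).ne'
    rw [pow_add]
    field_simp

/-- The Robinson-Colombeau ring of generalized numbers over `𝕜 = ℝ` or `𝕜 = ℂ`. -/
def GenNum (ρ : Gauge) (𝕜 : Type) [RCLike 𝕜] : Type :=
  moderateNets ρ 𝕜 ⧸ negligibleNets ρ 𝕜

instance (ρ : Gauge) (𝕜 : Type) [RCLike 𝕜] : CommRing (GenNum ρ 𝕜) :=
  inferInstanceAs (CommRing (moderateNets ρ 𝕜 ⧸ negligibleNets ρ 𝕜))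

abbrev GenR (ρ : Gauge) : Type := GenNum ρ ℝ
abbrev GenC (ρ : Gauge) : Type := GenNum ρ ℂ

/-- The class `[x_ε]` of a moderate net. -/
def cls (ρ : Gauge) {𝕜 : Type} [RCLike 𝕜] : moderateNets ρ 𝕜 →+* GenNum ρ 𝕜 :=
  Ideal.Quotient.mk (negligibleNets ρ 𝕜)

/-- `(x_ε)` is a (moderate) representative of the generalized number `a`: `a = [x_ε]`. -/
def IsRep (ρ : Gauge) {𝕜 : Type} [RCLike 𝕜] (x : Idx → 𝕜) (a : GenNum ρ 𝕜) : Prop :=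
  ∃ hx : x ∈ moderateNets ρ 𝕜, cls ρ ⟨x, hx⟩ = a

theorem exists_rep (ρ : Gauge) {𝕜 : Type} [RCLike 𝕜] (a : GenNum ρ 𝕜) :
    ∃ x : Idx → 𝕜, IsRep ρ x a := by
  obtain ⟨x, hx⟩ := Ideal.Quotient.mk_surjective (I := negligibleNets ρ 𝕜) a
  exact ⟨x, x.2, hx⟩

/-- A chosen representative of a generalized number. -/
def rep (ρ : Gauge) {𝕜 : Type} [RCLike 𝕜] (a : GenNum ρ 𝕜) : Idx → 𝕜 :=
  (exists_rep ρ a).choose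

open Classical in
/-- The class `[x_ε]` of an arbitrary net, with the value `0` if the net is not moderate. -/
def ofNet (ρ : Gauge) {𝕜 : Type} [RCLike 𝕜] (x : Idx → 𝕜) : GenNum ρ 𝕜 :=
  if hx : x ∈ moderateNets ρ 𝕜 then cls ρ ⟨x, hx⟩ else 0

/-- The embedding of standard numbers through constant nets. -/
def std (ρ : Gauge) {𝕜 : Type} [RCLike 𝕜] (c : 𝕜) : GenNum ρ 𝕜 :=
  cls ρ ⟨fun _ => c, isModerate_const ρ c⟩

/-! ## Order, modulus, sharp topology -/

/-- `x ≤ y`: for every representative of `x` there is one of `y` with `x_ε ≤ y_ε` for small `ε`. -/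
instance (ρ : Gauge) : LE (GenR ρ) where
  le a b := ∀ x, IsRep ρ x a → ∃ y, IsRep ρ y b ∧ ∀ᶠ ε in small, x ε ≤ y ε

/-- `x < y`: `x ≤ y` and `x - y` is invertible. -/
instance (ρ : Gauge) : LT (GenR ρ) where
  lt a b := a ≤ b ∧ IsUnit (a - b)

theorem norm_mem_moderate {ρ : Gauge} {𝕜 : Type} [RCLike 𝕜] (x : moderateNets ρ 𝕜) :
    (fun ε => ‖(x : Idx → 𝕜) ε‖) ∈ moderateNets ρ ℝ := by
  obtain ⟨N, hN⟩ := x.2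
  exact ⟨N, hN.norm_left⟩

/-- The modulus `|[z_ε]| = [|z_ε|]`. -/
def modulus (ρ : Gauge) {𝕜 : Type} [RCLike 𝕜] : GenNum ρ 𝕜 → GenR ρ :=
  Quotient.lift (fun x : moderateNets ρ 𝕜 =>
      cls ρ (⟨fun ε => ‖(x : Idx → 𝕜) ε‖, norm_mem_moderate x⟩ : moderateNets ρ ℝ)) (by
    intro x y hxy
    refine Ideal.Quotient.eq.mpr fun N => ?_
    have h : (x - y : moderateNets ρ 𝕜) ∈ negligibleNets ρ 𝕜 :=
      (Submodule.quotientRel_def _).mp hxy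
    refine Asymptotics.IsBigO.trans ?_ (h N)
    exact Asymptotics.IsBigO.of_bound 1 (Eventually.of_forall fun ε => by
      simpa using abs_norm_sub_norm_le ((x : Idx → 𝕜) ε) ((y : Idx → 𝕜) ε)))

/-- The generalized number `dρ^q = [ρ_ε^q]`, `q ≥ 0`. -/
def dρ (ρ : Gauge) (q : ℝ) : GenR ρ := ofNet ρ fun ε => ρ ε ^ q

/-- The sharp ball `B_r(z)`. -/
def ball (ρ : Gauge) (z : GenC ρ) (r : GenR ρ) : Set (GenC ρ) :=
  {w | modulus ρ (w - z) < r}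

/-- Open sets of the sharp topology. -/
def IsSharplyOpen (ρ : Gauge) (U : Set (GenC ρ)) : Prop :=
  ∀ z ∈ U, ∃ r : GenR ρ, 0 < r ∧ ball ρ z r ⊆ U

/-- The strongly internal set `⟨A_ε⟩`. -/
def sint (ρ : Gauge) (A : Idx → Set ℂ) : Set (GenC ρ) :=
  {z | ∀ x, IsRep ρ x z → ∀ᶠ ε in small, x ε ∈ A ε}

/-- `[x_ε] = z` for some representative with `lim x_ε = c`: the number `z` is near-standard with
standard part `c`. -/
def HasStdPart (ρ : Gauge) (z : GenC ρ) (c : ℂ) : Prop :=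
  ∃ x, IsRep ρ x z ∧ Tendsto x small (𝓝 c)

/-! ## Basic functions and generalized holomorphic functions

Maps `U → GenC ρ` are represented by functions `GenC ρ → GenC ρ` of which only the values on `U`
are used. -/

/-- The net `f_ε : A_ε → ℂ` defines the map `F : U → GenC ρ` (so that `F` is a basic function). -/
def Defines (ρ : Gauge) (U : Set (GenC ρ)) (A : Idx → Set ℂ) (f : Idx → ℂ → ℂ)
    (F : GenC ρ → GenC ρ) : Prop :=
  U ⊆ sint ρ A ∧ ∀ z ∈ U, ∀ x, IsRep ρ x z → IsRep ρ (fun ε => f ε (x ε)) (F z)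

/-- Differentiability of `F : U → GenC ρ` on the subset `V`, with the strong little-oh: the net
`f_ε : A_ε → ℂ` defines `F` and, as `h → 0` with increments `h` from `K ⊆ ℂ`,
`F (z + v h) = F z + h * D z + h * r (z, h)` holds in each `z ∈ V`, both for generalized numbers
and `ε`-wise, where `r` is a basic function defined for `h ∈ U₀` with `z + v h ∈ U`.
For `K = ℂ` and `v = 1` this is complex differentiability; `K = ℝ` with `v = 1`, `v = i` gives
the partial derivatives with respect to `x` and `y`. -/
def StrongDiffOn (ρ : Gauge) (K : Set ℂ) (v : ℂ) (U V : Set (GenC ρ)) (F D : GenC ρ → GenC ρ)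
    (A : Idx → Set ℂ) (f : Idx → ℂ → ℂ) : Prop :=
  Defines ρ U A f F ∧
  ∃ (U₀ : Set (GenC ρ)) (r : Idx → ℂ → ℂ → ℂ) (R : GenC ρ → GenC ρ → GenC ρ),
    (∀ z ∈ V, ∃ s : GenR ρ, 0 < s ∧ ∀ h y, IsRep ρ y h → (∀ ε, y ε ∈ K) → modulus ρ h < s →
      h ∈ U₀ ∧ z + std ρ v * h ∈ U) ∧
    (∀ z ∈ V, ∀ h ∈ U₀, z + std ρ v * h ∈ U → ∀ x y, IsRep ρ x z → IsRep ρ y h →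
      (∀ ε, y ε ∈ K) → IsRep ρ (fun ε => r ε (x ε) (y ε)) (R z h)) ∧
    ∀ z ∈ V,
      (∀ q : ℕ, ∃ H : GenR ρ, 0 < H ∧ ∀ h ∈ U₀, z + std ρ v * h ∈ U →
        (∃ y, IsRep ρ y h ∧ ∀ ε, y ε ∈ K) →
        0 < modulus ρ h → modulus ρ h < H → modulus ρ (R z h) < dρ ρ q) ∧
      ∀ x, IsRep ρ x z → ∃ m, IsRep ρ m (D z) ∧
        ∀ h ∈ U₀, z + std ρ v * h ∈ U → ∀ y, IsRep ρ y h → (∀ ε, y ε ∈ K) →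
          ∀ᶠ ε in small,
            f ε (x ε + v * y ε) = f ε (x ε) + y ε * m ε + y ε * r ε (x ε) (y ε) ∧
            r ε (x ε) 0 = 0 ∧ Tendsto (fun t => r ε (x ε) t) (𝓝[K] 0) (𝓝 0)

/-- `F` is a generalized holomorphic function on the nonempty sharply open set `U`. -/
def IsGHF (ρ : Gauge) (U : Set (GenC ρ)) (F : GenC ρ → GenC ρ) : Prop :=
  U.Nonempty ∧ IsSharplyOpen ρ U ∧
  ∃ (A : Idx → Set ℂ) (f : Idx → ℂ → ℂ) (D : GenC ρ → GenC ρ),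
    (∀ ε, IsOpen (A ε) ∧ DifferentiableOn ℂ (f ε) (A ε)) ∧
    StrongDiffOn ρ Set.univ 1 U U F D A f

/-- On the sharply open set `U`, the map `G` is the partial derivative of `F` with respect to `x`
(`v = 1`) or to `y` (`v = i`), with representatives that are partially differentiable. -/
def IsPartialDeriv (ρ : Gauge) (v : ℂ) (U : Set (GenC ρ)) (F G : GenC ρ → GenC ρ) : Prop :=
  IsSharplyOpen ρ U ∧
  ∃ (A : Idx → Set ℂ) (f : Idx → ℂ → ℂ),
    (∀ ε, IsOpen (A ε) ∧ ∀ z ∈ A ε,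
      LineDifferentiableAt ℝ (f ε) z 1 ∧ LineDifferentiableAt ℝ (f ε) z Complex.I) ∧
    StrongDiffOn ρ (Set.range ((↑) : ℝ → ℂ)) v U U F G A f

/-- On `U`, the map `G` is `∂^α F = ∂₁^a ∂₂^b F`, `α = (a, b)`. -/
def IsIterPartialDeriv (ρ : Gauge) (U : Set (GenC ρ)) :
    ℕ → ℕ → (GenC ρ → GenC ρ) → (GenC ρ → GenC ρ) → Prop
  | 0, 0, F, G => Set.EqOn F G U
  | 0, b + 1, F, G => ∃ H, IsIterPartialDeriv ρ U 0 b F H ∧ IsPartialDeriv ρ Complex.I U H G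
  | a + 1, b, F, G => ∃ H, IsIterPartialDeriv ρ U a b F H ∧ IsPartialDeriv ρ 1 U H G

/-! ## Weak derivatives and the distributional Cauchy-Riemann equations -/

/-- `g` is the weak derivative `∂^α f` on `Ω`, `α = (a, b)`, for the coordinates `z = x + i y`. -/
def IsWeakDeriv (Ω : Opens ℂ) (a b : ℕ) (f g : ℂ → ℂ) : Prop :=
  ∀ φ : 𝓓(Ω, ℂ),
    ∫ z in Ω, f z * ((fun ψ : 𝓓(Ω, ℂ) => ∂_{(1 : ℂ)} ψ)^[a]
        ((fun ψ : 𝓓(Ω, ℂ) => ∂_{Complex.I} ψ)^[b] φ)) z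
      = (-1) ^ (a + b) * ∫ z in Ω, g z * φ z

/-- `∂f/∂z̄ = (∂₁ f + i ∂₂ f) / 2 = 0` on `Ω` in the sense of distributions. -/
def SatisfiesCRE (Ω : Opens ℂ) (f : ℂ → ℂ) : Prop :=
  ∀ φ : 𝓓(Ω, ℂ),
    ∫ z in Ω, f z * ((∂_{(1 : ℂ)} φ : 𝓓(Ω, ℂ)) z + Complex.I * (∂_{Complex.I} φ : 𝓓(Ω, ℂ)) z) = 0

/-! ## The embedding -/

/-- `k_ε(z) = ρ_ε⁻² k(ρ_ε⁻¹ z)`. -/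
def scaled (ρ : Gauge) (k : ℂ → ℂ) (ε : Idx) (z : ℂ) : ℂ :=
  ((ρ ε : ℂ) ^ 2)⁻¹ * k ((ρ ε : ℂ)⁻¹ * z)

/-- `(f * k_ε)(z) = ∫_Ω f(ζ) k_ε(z - ζ) dζ`. -/
def conv (ρ : Gauge) (Ω : Opens ℂ) (k f : ℂ → ℂ) (ε : Idx) (z : ℂ) : ℂ :=
  ∫ ζ in Ω, f ζ * scaled ρ k ε (z - ζ)

/-- The points of `Ω` where the convolution of a function given on `Ω` with `k_ε` is defined:
`z - supp k_ε ⊆ Ω`. -/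
def convDom (ρ : Gauge) (Ω : Opens ℂ) (k : ℂ → ℂ) (ε : Idx) : Set ℂ :=
  {z | z ∈ Ω ∧ ∀ w ∈ tsupport (scaled ρ k ε), z - w ∈ Ω}

/-- The domain `d_f`: the generalized points `z = [z_ε]` such that for some real `q > 0`
the ball `B_{dρ^q}(z)` is contained in `⟨Ω⟩`, for small `ε` the function `f * k_ε` is (defined and)
holomorphic on the Euclidean ball of radius `ρ_ε^q` at `z_ε`, and on `B_{dρ^q}(z)` the net
`(f * k_ε)` defines a basic function and has moderate first derivatives. -/
def embDom (ρ : Gauge) (Ω : Opens ℂ) (k f : ℂ → ℂ) : Set (GenC ρ) :=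
  {z | ∃ q : ℝ, 0 < q ∧ ∃ x, IsRep ρ x z ∧
    ball ρ z (dρ ρ q) ⊆ sint ρ (fun _ => (Ω : Set ℂ)) ∧
    (∀ᶠ ε in small, Metric.ball (x ε) (ρ ε ^ q) ⊆ convDom ρ Ω k ε ∧
      DifferentiableOn ℂ (conv ρ Ω k f ε) (Metric.ball (x ε) (ρ ε ^ q))) ∧
    (∃ F, Defines ρ (ball ρ z (dρ ρ q)) (fun _ => (Ω : Set ℂ)) (conv ρ Ω k f) F) ∧
    ∀ c ∈ ball ρ z (dρ ρ q), ∀ y, IsRep ρ y c →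
      IsModerate ρ (fun ε => deriv (conv ρ Ω k f ε) (y ε))}

/-- The embedding `𝒿(f) : [z_ε] ∈ d_f ↦ [(f * k_ε)(z_ε)]`. -/
def emb (ρ : Gauge) (Ω : Opens ℂ) (k f : ℂ → ℂ) (z : GenC ρ) : GenC ρ :=
  ofNet ρ fun ε => conv ρ Ω k f ε (rep ρ z ε)

end GHF

end

noncomputable section

namespace GHF

open scoped ContDiff

instance small_neBot : (small).NeBot := by
  rw [small, ← mem_closure_iff_comap_neBot, closure_Ioc (by norm_num)]
  simp

section Toolkit

variable {ρ : Gauge} {𝕜 : Type} [RCLike 𝕜]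

theorem Gauge.eventually_le (ρ : Gauge) {δ : ℝ} (hδ : 0 < δ) : ∀ᶠ ε in small, ρ ε ≤ δ :=
  ρ.tendsto.eventually (eventually_le_nhds hδ)

theorem Gauge.pow_anti (ρ : Gauge) (ε : Idx) {M N : ℕ} (h : M ≤ N) : ρ ε ^ N ≤ ρ ε ^ M :=
  pow_le_pow_of_le_one (ρ.pos ε).le (ρ.le_one ε) h

theorem Gauge.inv_pow_mono (ρ : Gauge) (ε : Idx) {M N : ℕ} (h : M ≤ N) :
    (ρ ε ^ M)⁻¹ ≤ (ρ ε ^ N)⁻¹ :=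
  inv_anti₀ (pow_pos (ρ.pos ε) _) (ρ.pow_anti ε h)

/-- Constants are absorbed by one power of the gauge. -/
theorem Gauge.eventually_mul_pow_le (ρ : Gauge) (C : ℝ) {M N : ℕ} (h : M < N) :
    ∀ᶠ ε in small, C * ρ ε ^ N ≤ ρ ε ^ M := by
  filter_upwards [ρ.eventually_le (δ := (|C| + 1)⁻¹) (by positivity)] with ε hε
  have hp := ρ.pos ε
  calc C * ρ ε ^ N ≤ |C| * ρ ε ^ (M + 1) := by
        refine (mul_le_mul_of_nonneg_right (le_abs_self C) (by positivity)).trans ?_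
        exact mul_le_mul_of_nonneg_left (ρ.pow_anti ε h) (abs_nonneg C)
    _ = (|C| * ρ ε) * ρ ε ^ M := by ring
    _ ≤ 1 * ρ ε ^ M := by
        gcongr
        calc |C| * ρ ε ≤ (|C| + 1) * ρ ε := by gcongr; linarith
          _ ≤ (|C| + 1) * (|C| + 1)⁻¹ := by gcongr
          _ = 1 := mul_inv_cancel₀ (by positivity)
    _ = ρ ε ^ M := one_mul _

theorem Gauge.eventually_mul_inv_pow_le (ρ : Gauge) (C : ℝ) {M N : ℕ} (h : M < N) :
    ∀ᶠ ε in small, C * (ρ ε ^ M)⁻¹ ≤ (ρ ε ^ N)⁻¹ := by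
  filter_upwards [ρ.eventually_mul_pow_le C h] with ε hε
  have hM := pow_pos (ρ.pos ε) M
  have hN := pow_pos (ρ.pos ε) N
  rw [← div_eq_mul_inv, div_le_iff₀ hM, inv_mul_eq_div, le_div_iff₀ hN]
  exact hε

theorem isModerate_of_le {x : Idx → 𝕜} (C : ℝ) (N : ℕ)
    (h : ∀ᶠ ε in small, ‖x ε‖ ≤ C * (ρ ε ^ N)⁻¹) : IsModerate ρ x := by
  refine ⟨N, Asymptotics.IsBigO.of_bound C (h.mono fun ε hε => ?_)⟩
  rwa [Real.norm_of_nonneg (inv_nonneg.2 (pow_pos (ρ.pos ε) N).le)]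

theorem IsModerate.exists_le {x : Idx → 𝕜} (h : IsModerate ρ x) :
    ∃ N : ℕ, ∀ᶠ ε in small, ‖x ε‖ ≤ (ρ ε ^ N)⁻¹ := by
  obtain ⟨N, hN⟩ := h
  obtain ⟨C, hC⟩ := hN.bound
  refine ⟨N + 1, ?_⟩
  filter_upwards [hC, ρ.eventually_mul_inv_pow_le C N.lt_succ_self] with ε h1 h2
  rw [Real.norm_of_nonneg (inv_nonneg.2 (pow_pos (ρ.pos ε) N).le)] at h1
  exact h1.trans h2

theorem isNegligible_of_le {x : Idx → 𝕜}
    (h : ∀ N : ℕ, ∃ C : ℝ, ∀ᶠ ε in small, ‖x ε‖ ≤ C * ρ ε ^ N) : IsNegligible ρ x := by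
  intro N
  obtain ⟨C, hC⟩ := h N
  refine Asymptotics.IsBigO.of_bound C (hC.mono fun ε hε => ?_)
  rwa [Real.norm_of_nonneg (pow_pos (ρ.pos ε) N).le]

theorem IsNegligible.eventually_le {x : Idx → 𝕜} (h : IsNegligible ρ x) (N : ℕ) :
    ∀ᶠ ε in small, ‖x ε‖ ≤ ρ ε ^ N := by
  obtain ⟨C, hC⟩ := (h (N + 1)).bound
  filter_upwards [hC, ρ.eventually_mul_pow_le C N.lt_succ_self] with ε h1 h2
  rw [Real.norm_of_nonneg (pow_pos (ρ.pos ε) _).le] at h1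
  exact h1.trans h2

theorem IsNegligible.isModerate {x : Idx → 𝕜} (h : IsNegligible ρ x) : IsModerate ρ x :=
  isModerate_of_le 1 0 ((h.eventually_le 0).mono fun ε hε => by simpa using hε)

/-! ### Representatives -/

theorem IsRep.moderate {x : Idx → 𝕜} {a : GenNum ρ 𝕜} (h : IsRep ρ x a) : IsModerate ρ x := h.1

theorem IsRep.negligible_sub {x y : Idx → 𝕜} {a : GenNum ρ 𝕜} (hx : IsRep ρ x a)
    (hy : IsRep ρ y a) : IsNegligible ρ (x - y) := by
  obtain ⟨hx, h1⟩ := hx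
  obtain ⟨hy, h2⟩ := hy
  exact Ideal.Quotient.eq.mp (h1.trans h2.symm)

theorem IsRep.of_negligible_sub {x y : Idx → 𝕜} {a : GenNum ρ 𝕜} (hx : IsRep ρ x a)
    (h : IsNegligible ρ (y - x)) : IsRep ρ y a := by
  obtain ⟨hx, h1⟩ := hx
  have hy : y ∈ moderateNets ρ 𝕜 := by
    have := IsModerate.add h.isModerate hx
    rwa [sub_add_cancel] at this
  exact ⟨hy, (Ideal.Quotient.eq (I := negligibleNets ρ 𝕜).mpr h).trans h1⟩

theorem IsRep.of_eventuallyEq {x y : Idx → 𝕜} {a : GenNum ρ 𝕜} (hx : IsRep ρ x a)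
    (h : y =ᶠ[small] x) : IsRep ρ y a :=
  hx.of_negligible_sub <| isNegligible_of_le fun N => ⟨0, h.mono fun ε hε => by simp [hε]⟩

theorem IsRep.unique {x y : Idx → 𝕜} {a b : GenNum ρ 𝕜} (hx : IsRep ρ x a) (hy : IsRep ρ y b)
    (h : IsNegligible ρ (x - y)) : a = b := by
  obtain ⟨_, h1⟩ := hy.of_negligible_sub h
  obtain ⟨_, h2⟩ := hx
  rw [← h1, ← h2]

theorem isRep_rep (a : GenNum ρ 𝕜) : IsRep ρ (rep ρ a) a := (exists_rep ρ a).choose_spec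

theorem isRep_ofNet {x : Idx → 𝕜} (hx : IsModerate ρ x) : IsRep ρ x (ofNet ρ x) := by
  have hx' : x ∈ moderateNets ρ 𝕜 := hx
  exact ⟨hx', by rw [ofNet, dif_pos hx']⟩

theorem IsRep.ofNet_eq {x : Idx → 𝕜} {a : GenNum ρ 𝕜} (h : IsRep ρ x a) : ofNet ρ x = a := by
  obtain ⟨h1, h2⟩ := h
  rw [ofNet, dif_pos h1, h2]

theorem isRep_std (c : 𝕜) : IsRep ρ (fun _ => c) (std ρ c) := ⟨isModerate_const ρ c, rfl⟩

theorem isRep_zero : IsRep ρ (fun _ => (0 : 𝕜)) (0 : GenNum ρ 𝕜) :=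
  ⟨isModerate_const ρ 0, map_zero (cls ρ)⟩

theorem IsRep.add {x y : Idx → 𝕜} {a b : GenNum ρ 𝕜} (hx : IsRep ρ x a) (hy : IsRep ρ y b) :
    IsRep ρ (fun ε => x ε + y ε) (a + b) := by
  obtain ⟨h1, rfl⟩ := hx
  obtain ⟨h2, rfl⟩ := hy
  exact ⟨IsModerate.add h1 h2, map_add (cls ρ) ⟨x, h1⟩ ⟨y, h2⟩⟩

theorem IsRep.sub {x y : Idx → 𝕜} {a b : GenNum ρ 𝕜} (hx : IsRep ρ x a) (hy : IsRep ρ y b) :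
    IsRep ρ (fun ε => x ε - y ε) (a - b) := by
  obtain ⟨h1, rfl⟩ := hx
  obtain ⟨h2, rfl⟩ := hy
  exact ⟨(moderateNets ρ 𝕜).sub_mem h1 h2, map_sub (cls ρ) ⟨x, h1⟩ ⟨y, h2⟩⟩

theorem IsRep.mul {x y : Idx → 𝕜} {a b : GenNum ρ 𝕜} (hx : IsRep ρ x a) (hy : IsRep ρ y b) :
    IsRep ρ (fun ε => x ε * y ε) (a * b) := by
  obtain ⟨h1, rfl⟩ := hx
  obtain ⟨h2, rfl⟩ := hy
  exact ⟨IsModerate.mul h1 h2, map_mul (cls ρ) ⟨x, h1⟩ ⟨y, h2⟩⟩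

theorem IsRep.modulus {x : Idx → 𝕜} {a : GenNum ρ 𝕜} (hx : IsRep ρ x a) :
    IsRep ρ (fun ε => ‖x ε‖) (modulus ρ a) := by
  obtain ⟨h1, rfl⟩ := hx
  exact ⟨norm_mem_moderate ⟨x, h1⟩, rfl⟩

theorem isRep_dρ {q : ℝ} (hq : 0 ≤ q) : IsRep ρ (fun ε => ρ ε ^ q) (dρ ρ q) := by
  refine isRep_ofNet (isModerate_of_le 1 0 (Eventually.of_forall fun ε => ?_))
  rw [Real.norm_of_nonneg (Real.rpow_nonneg (ρ.pos ε).le q)]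
  simpa using Real.rpow_le_one (ρ.pos ε).le (ρ.le_one ε) hq

theorem isRep_dρ_nat (n : ℕ) : IsRep ρ (fun ε => ρ ε ^ n) (dρ ρ n) := by
  simpa using isRep_dρ (ρ := ρ) n.cast_nonneg

/-! ### The strict order through representatives -/

theorem lt_iff {x y : Idx → ℝ} {a b : GenR ρ} (hx : IsRep ρ x a) (hy : IsRep ρ y b) :
    a < b ↔ ∃ N : ℕ, ∀ᶠ ε in small, x ε + ρ ε ^ N ≤ y ε := by
  constructor
  · rintro ⟨hle, hu⟩
    obtain ⟨c, hc⟩ := hu.exists_right_inv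
    obtain ⟨w, hw⟩ := exists_rep ρ c
    obtain ⟨N, hN⟩ := hw.moderate.exists_le
    have h1 : IsRep ρ (fun ε => (x ε - y ε) * w ε) (1 : GenR ρ) := hc ▸ (hx.sub hy).mul hw
    have h2 : IsRep ρ (fun _ => (1 : ℝ)) (1 : GenR ρ) := ⟨isModerate_const ρ 1, map_one (cls ρ)⟩
    have h3 := (h1.negligible_sub h2).eventually_le 1
    obtain ⟨y', hy', hxy⟩ := hle x hx
    have h4 := (hy'.negligible_sub hy).eventually_le (N + 2)
    refine ⟨N + 1, ?_⟩
    filter_upwards [hN, h3, hxy, h4, ρ.eventually_le (δ := 1 / 4) (by norm_num)]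
      with ε a1 a2 a3 a4 a5
    simp only [Pi.sub_apply, Real.norm_eq_abs, pow_one] at a1 a2 a4
    have hp := ρ.pos ε
    have hpN := pow_pos hp N
    have h5 : 1 / 2 ≤ |x ε - y ε| * |w ε| := by
      rw [← abs_mul]
      have := abs_le.1 a2
      have := le_abs_self ((x ε - y ε) * w ε)
      linarith
    have h6 : ρ ε ^ N / 2 ≤ |x ε - y ε| := by
      have : 1 / 2 ≤ |x ε - y ε| * (ρ ε ^ N)⁻¹ := h5.trans (by gcongr)
      rw [← div_eq_mul_inv, le_div_iff₀ hpN] at this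
      linarith
    have h7 : ρ ε ^ (N + 2) ≤ ρ ε ^ N / 16 := by
      have : ρ ε ^ 2 ≤ 1 / 16 := by nlinarith
      rw [pow_add]
      nlinarith
    have h8 : ρ ε ^ (N + 1) ≤ ρ ε ^ N / 4 := by
      rw [pow_succ]; nlinarith
    have h9 := abs_le.1 a4
    rcases abs_cases (x ε - y ε) with ⟨h, _⟩ | ⟨h, _⟩ <;> rw [h] at h6 <;> linarith
  · rintro ⟨N, hN⟩
    refine ⟨fun x' hx' => ⟨fun ε => max (x' ε) (y ε), hy.of_negligible_sub
      (isNegligible_of_le fun M => ⟨1, ?_⟩), Eventually.of_forall fun ε => le_max_left _ _⟩, ?_⟩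
    · filter_upwards [hN, (hx'.negligible_sub hx).eventually_le N] with ε h1 h2
      have hxy : x' ε ≤ y ε := by
        have := (abs_le.1 h2).2
        simp only [Pi.sub_apply] at this
        linarith
      have := pow_pos (ρ.pos ε) M
      simpa [max_eq_right hxy] using this.le
    · have hm : IsModerate ρ (fun ε => (x ε - y ε)⁻¹) := by
        refine isModerate_of_le 1 N (hN.mono fun ε hε => ?_)
        have hpN := pow_pos (ρ.pos ε) N
        rw [one_mul, norm_inv, Real.norm_eq_abs]
        refine inv_anti₀ hpN ?_
        rw [abs_sub_comm]
        exact (by linarith : ρ ε ^ N ≤ y ε - x ε).trans (le_abs_self _)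
      refine IsUnit.of_mul_eq_one (ofNet ρ fun ε => (x ε - y ε)⁻¹) ?_
      have h2 : IsRep ρ (fun _ => (1 : ℝ)) (1 : GenR ρ) := ⟨isModerate_const ρ 1, map_one (cls ρ)⟩
      refine ((hx.sub hy).mul (isRep_ofNet hm)).unique h2
        (isNegligible_of_le fun M => ⟨0, hN.mono fun ε hε => ?_⟩)
      have hpN := pow_pos (ρ.pos ε) N
      have : x ε - y ε ≠ 0 := by intro h; linarith
      simp [this]

theorem pos_iff {y : Idx → ℝ} {b : GenR ρ} (hy : IsRep ρ y b) :
    0 < b ↔ ∃ N : ℕ, ∀ᶠ ε in small, ρ ε ^ N ≤ y ε := by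
  simpa using lt_iff isRep_zero hy

theorem dρ_pos {q : ℝ} (hq : 0 ≤ q) : 0 < dρ ρ q := by
  refine (pos_iff (isRep_dρ hq)).2 ⟨⌈q⌉₊, Eventually.of_forall fun ε => ?_⟩
  rw [← Real.rpow_natCast]
  exact Real.rpow_le_rpow_of_exponent_ge (ρ.pos ε) (ρ.le_one ε) (Nat.le_ceil q)

theorem mem_ball_iff {x y : Idx → ℂ} {z c : GenC ρ} {s : Idx → ℝ} {r : GenR ρ}
    (hx : IsRep ρ x z) (hy : IsRep ρ y c) (hs : IsRep ρ s r) :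
    c ∈ ball ρ z r ↔ ∃ N : ℕ, ∀ᶠ ε in small, ‖y ε - x ε‖ + ρ ε ^ N ≤ s ε :=
  lt_iff (hy.sub hx).modulus hs

/-- Every positive radius dominates a power of the gauge. -/
theorem exists_ball_dρ_subset (z : GenC ρ) {r : GenR ρ} (hr : 0 < r) :
    ∃ N : ℕ, ball ρ z (dρ ρ N) ⊆ ball ρ z r := by
  obtain ⟨s, hs⟩ := exists_rep ρ r
  obtain ⟨N, hN⟩ := (pos_iff hs).1 hr
  refine ⟨N, fun c hc => ?_⟩
  obtain ⟨x, hx⟩ := exists_rep ρ z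
  obtain ⟨y, hy⟩ := exists_rep ρ c
  obtain ⟨M, hM⟩ := (mem_ball_iff hx hy (isRep_dρ_nat N)).1 hc
  exact (mem_ball_iff hx hy hs).2 ⟨M, by filter_upwards [hN, hM] with ε h1 h2 using h2.trans h1⟩

/-- Around each point of a ball of radius `dρ^q` there are smaller balls inside it, both for
generalized and for standard points. -/
theorem exists_ball_subset_ball {q : ℝ} (hq : 0 < q) {x y : Idx → ℂ} {z c : GenC ρ}
    (hx : IsRep ρ x z) (hy : IsRep ρ y c) (hc : c ∈ ball ρ z (dρ ρ q)) :
    ∃ p : ℕ, 0 < p ∧ ball ρ c (dρ ρ p) ⊆ ball ρ z (dρ ρ q) ∧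
      ∀ᶠ ε in small, Metric.ball (y ε) (ρ ε ^ p) ⊆ Metric.ball (x ε) (ρ ε ^ q) := by
  obtain ⟨N, hN⟩ := (mem_ball_iff hx hy (isRep_dρ hq.le)).1 hc
  have hsub : ∀ᶠ ε in small, ρ ε ^ (N + 1) ≤ ρ ε ^ N :=
    Eventually.of_forall fun ε => ρ.pow_anti ε (Nat.le_succ N)
  refine ⟨N + 1, Nat.succ_pos N, fun w hw => ?_, ?_⟩
  · obtain ⟨u, hu⟩ := exists_rep ρ w
    obtain ⟨M, hM⟩ := (mem_ball_iff hy hu (isRep_dρ_nat _)).1 hw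
    refine (mem_ball_iff hx hu (isRep_dρ hq.le)).2 ⟨M, ?_⟩
    filter_upwards [hN, hM, hsub] with ε h1 h2 h3
    have := norm_sub_le_norm_sub_add_norm_sub (u ε) (y ε) (x ε)
    linarith
  · filter_upwards [hN, hsub] with ε h1 h3 w hw
    rw [mem_ball_iff_norm] at hw ⊢
    have := norm_sub_le_norm_sub_add_norm_sub w (y ε) (x ε)
    linarith

theorem isSharplyOpen_ball {q : ℝ} (hq : 0 < q) (z : GenC ρ) :
    IsSharplyOpen ρ (ball ρ z (dρ ρ q)) := by
  intro c hc
  obtain ⟨p, _, h, _⟩ := exists_ball_subset_ball hq (isRep_rep z) (isRep_rep c) hc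
  exact ⟨_, dρ_pos p.cast_nonneg, h⟩

theorem mem_ball_self {q : ℝ} (hq : 0 ≤ q) (z : GenC ρ) : z ∈ ball ρ z (dρ ρ q) := by
  obtain ⟨N, hN⟩ := (pos_iff (isRep_dρ hq)).1 (dρ_pos (ρ := ρ) hq)
  exact (mem_ball_iff (isRep_rep z) (isRep_rep z) (isRep_dρ hq)).2 ⟨N, by simpa using hN⟩

end Toolkit

/-- Second order Taylor bound for a bounded holomorphic function on a disc. -/
theorem norm_dslope_sub_deriv_le {f : ℂ → ℂ} {x w : ℂ} {R B : ℝ}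
    (hf : DifferentiableOn ℂ f (Metric.ball x R)) (hB : ∀ u ∈ Metric.ball x R, ‖f u‖ ≤ B)
    (hw : w ∈ Metric.ball x R) :
    ‖dslope f x w - deriv f x‖ ≤ 4 * B / R ^ 2 * ‖w - x‖ ∧ ‖deriv f x‖ ≤ 2 * B / R := by
  have hR : 0 < R := Metric.pos_of_mem_ball hw
  have hxm : x ∈ Metric.ball x R := Metric.mem_ball_self hR
  have h1 : ∀ u ∈ Metric.ball x R, ‖dslope f x u‖ ≤ 2 * B / R := fun u hu =>
    Complex.norm_dslope_le_div_of_mapsTo_ball hf (fun t ht => by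
      rw [mem_closedBall_iff_norm]
      exact (norm_sub_le _ _).trans (by linarith [hB t ht, hB x hxm])) hu
  have h2 : ‖dslope (dslope f x) x w‖ ≤ 4 * B / R / R :=
    Complex.norm_dslope_le_div_of_mapsTo_ball
      ((Complex.differentiableOn_dslope (Metric.ball_mem_nhds x hR)).2 hf) (fun t ht => by
        rw [mem_closedBall_iff_norm]
        refine (norm_sub_le _ _).trans ((add_le_add (h1 t ht) (h1 x hxm)).trans (le_of_eq ?_))
        ring) hw
  refine ⟨?_, by simpa using h1 x hxm⟩
  rw [← dslope_same f x, ← sub_smul_dslope (dslope f x), norm_smul, mul_comm]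
  refine mul_le_mul_of_nonneg_right (h2.trans (le_of_eq ?_)) (norm_nonneg _)
  rw [div_div, sq]

section Nets

variable {ρ : Gauge} {U : Set (GenC ρ)} {A : Idx → Set ℂ} {f : Idx → ℂ → ℂ}
  {F : GenC ρ → GenC ρ}

/-- Nets of points sufficiently close to a representative of a point of a sharply open set
represent points of this set. -/
theorem IsSharplyOpen.exists_isRep (hU : IsSharplyOpen ρ U) {z : GenC ρ} (hz : z ∈ U)
    {x : Idx → ℂ} (hx : IsRep ρ x z) :
    ∃ N : ℕ, ∀ y : Idx → ℂ, (∀ᶠ ε in small, ‖y ε - x ε‖ ≤ ρ ε ^ N) → ∃ c ∈ U, IsRep ρ y c := by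
  obtain ⟨r, hr, hrU⟩ := hU z hz
  obtain ⟨N, hN⟩ := exists_ball_dρ_subset z hr
  refine ⟨N + 1, fun y hy => ?_⟩
  have hm : IsModerate ρ y := by
    have : IsModerate ρ (y - x) := isModerate_of_le 1 0 (hy.mono fun ε hε => by
      simpa using hε.trans (pow_le_one₀ (ρ.pos ε).le (ρ.le_one ε)))
    simpa using this.add hx.moderate
  refine ⟨_, hrU (hN ?_), isRep_ofNet hm⟩
  refine (mem_ball_iff hx (isRep_ofNet hm) (isRep_dρ_nat N)).2 ⟨N + 1, ?_⟩
  filter_upwards [hy, ρ.eventually_mul_pow_le 2 N.lt_succ_self] with ε h1 h2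
  rw [Nat.succ_eq_add_one] at h2
  linarith

theorem Defines.exists_ball_bound (hU : IsSharplyOpen ρ U)
    (hf : ∀ ε, DifferentiableOn ℂ (f ε) (A ε)) (hF : Defines ρ U A f F)
    {z : GenC ρ} (hz : z ∈ U) {x : Idx → ℂ} (hx : IsRep ρ x z) :
    ∃ N : ℕ, ∀ᶠ ε in small, ∀ w ∈ Metric.closedBall (x ε) (ρ ε ^ N),
      w ∈ A ε ∧ ‖f ε w‖ ≤ (ρ ε ^ N)⁻¹ := by
  classical
  obtain ⟨N, hN⟩ := hU.exists_isRep hz hx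
  have hsel : ∀ P : Idx → ℂ → Prop, ∃ y : Idx → ℂ, (∃ c ∈ U, IsRep ρ y c) ∧
      ∀ ε, (∃ w ∈ Metric.closedBall (x ε) (ρ ε ^ N), P ε w) → P ε (y ε) := by
    intro P
    refine ⟨fun ε => if h : ∃ w ∈ Metric.closedBall (x ε) (ρ ε ^ N), P ε w then h.choose else x ε,
      hN _ (Eventually.of_forall fun ε => ?_), fun ε h => ?_⟩
    · by_cases h : ∃ w ∈ Metric.closedBall (x ε) (ρ ε ^ N), P ε w
      · rw [dif_pos h]
        exact mem_closedBall_iff_norm.1 h.choose_spec.1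
      · simpa only [dif_neg h, sub_self, norm_zero] using (pow_pos (ρ.pos ε) N).le
    · simpa only [dif_pos h] using h.choose_spec.2
  have hA : ∀ᶠ ε in small, Metric.closedBall (x ε) (ρ ε ^ N) ⊆ A ε := by
    obtain ⟨y, ⟨c, hc, hy⟩, hP⟩ := hsel fun ε w => w ∉ A ε
    filter_upwards [hF.1 hc y hy] with ε hε w hw
    by_contra hwA
    exact hP ε ⟨w, hw, hwA⟩ hε
  obtain ⟨y, ⟨c, hc, hy⟩, hP⟩ := hsel fun ε w =>
    ∀ u ∈ Metric.closedBall (x ε) (ρ ε ^ N), ‖f ε u‖ ≤ ‖f ε w‖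
  obtain ⟨M, hM⟩ := (hF.2 c hc y hy).moderate.exists_le
  refine ⟨max M N, ?_⟩
  filter_upwards [hA, hM] with ε hε h1 w hw
  have hw' : w ∈ Metric.closedBall (x ε) (ρ ε ^ N) :=
    Metric.closedBall_subset_closedBall (ρ.pow_anti ε (le_max_right M N)) hw
  refine ⟨hε hw', ?_⟩
  obtain ⟨u, hu, hmax⟩ := (isCompact_closedBall (x ε) (ρ ε ^ N)).exists_isMaxOn ⟨w, hw'⟩
    (((hf ε).mono hε).continuousOn.norm)
  exact (hP ε ⟨u, hu, fun t ht => hmax ht⟩ w hw').trans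
    (h1.trans (ρ.inv_pow_mono ε (le_max_left M N)))

theorem Defines.exists_taylor_bound (hU : IsSharplyOpen ρ U)
    (hf : ∀ ε, DifferentiableOn ℂ (f ε) (A ε)) (hF : Defines ρ U A f F)
    {z : GenC ρ} (hz : z ∈ U) {x : Idx → ℂ} (hx : IsRep ρ x z) :
    ∃ N : ℕ, ∀ᶠ ε in small, ‖deriv (f ε) (x ε)‖ ≤ (ρ ε ^ N)⁻¹ ∧
      ∀ w, ‖w - x ε‖ < ρ ε ^ N →
        ‖dslope (f ε) (x ε) w - deriv (f ε) (x ε)‖ ≤ (ρ ε ^ N)⁻¹ * ‖w - x ε‖ := by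
  obtain ⟨N, hN⟩ := hF.exists_ball_bound hU hf hz hx
  refine ⟨3 * N + 1, ?_⟩
  filter_upwards [hN, ρ.eventually_mul_inv_pow_le 4 (3 * N).lt_succ_self] with ε h1 h2
  have hp := pow_pos (ρ.pos ε) N
  have hp1 : ρ ε ^ N ≤ 1 := pow_le_one₀ (ρ.pos ε).le (ρ.le_one ε)
  have key := fun w hw => norm_dslope_sub_deriv_le (f := f ε) (x := x ε) (w := w)
    ((hf ε).mono fun w hw => (h1 w (Metric.ball_subset_closedBall hw)).1)
    (fun w hw => (h1 w (Metric.ball_subset_closedBall hw)).2) hw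
  have e1 : 4 * (ρ ε ^ N)⁻¹ / (ρ ε ^ N) ^ 2 = 4 * (ρ ε ^ (3 * N))⁻¹ := by
    rw [div_eq_mul_inv, mul_assoc, ← mul_inv, mul_comm 3 N, pow_mul]
    ring
  rw [e1] at key
  have e2 : 2 * (ρ ε ^ N)⁻¹ / ρ ε ^ N ≤ 4 * (ρ ε ^ (3 * N))⁻¹ := by
    rw [← e1]
    have h3 : (1 : ℝ) ≤ (ρ ε ^ N)⁻¹ := (one_le_inv₀ hp).2 hp1
    have h4 : 0 ≤ (ρ ε ^ N)⁻¹ * (ρ ε ^ N)⁻¹ := by positivity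
    calc 2 * (ρ ε ^ N)⁻¹ / ρ ε ^ N = 2 * ((ρ ε ^ N)⁻¹ * (ρ ε ^ N)⁻¹) := by ring
      _ ≤ 4 * ((ρ ε ^ N)⁻¹ * (ρ ε ^ N)⁻¹) * (ρ ε ^ N)⁻¹ := by nlinarith
      _ = _ := by field_simp
  refine ⟨((key _ (Metric.mem_ball_self hp)).2.trans e2).trans h2, fun w hw => ?_⟩
  have hw' : w ∈ Metric.ball (x ε) (ρ ε ^ N) :=
    mem_ball_iff_norm.2 (hw.trans_le (ρ.pow_anti ε (by omega)))
  exact (key w hw').1.trans (mul_le_mul_of_nonneg_right h2 (norm_nonneg _))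

/-- The derivatives of a net of holomorphic functions that defines a basic function on a sharply
open set define a basic function, too. -/
theorem Defines.exists_deriv (hU : IsSharplyOpen ρ U)
    (hf : ∀ ε, DifferentiableOn ℂ (f ε) (A ε)) (hF : Defines ρ U A f F) :
    ∃ D, Defines ρ U A (fun ε => deriv (f ε)) D := by
  have hmod : ∀ z ∈ U, ∀ x, IsRep ρ x z → IsModerate ρ fun ε => deriv (f ε) (x ε) := by
    intro z hz x hx
    obtain ⟨N, hN⟩ := hF.exists_taylor_bound hU hf hz hx
    exact isModerate_of_le 1 N (hN.mono fun ε hε => by simpa using hε.1)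
  refine ⟨fun z => ofNet ρ fun ε => deriv (f ε) (rep ρ z ε), hF.1, fun z hz x hx => ?_⟩
  refine (isRep_ofNet (hmod z hz _ (isRep_rep z))).of_negligible_sub (isNegligible_of_le fun n => ?_)
  have hx' := isRep_rep z
  set x' := rep ρ z
  obtain ⟨N₁, h₁⟩ := hF.exists_taylor_bound hU hf hz hx
  obtain ⟨N₂, h₂⟩ := hF.exists_taylor_bound hU hf hz hx'
  obtain ⟨N₃, h₃⟩ := hU.exists_isRep hz hx
  set K := N₁ + N₂ + N₃ + n + 1
  obtain ⟨c, hc, hw⟩ := h₃ (fun ε => x ε + (ρ ε : ℂ) ^ K) (Eventually.of_forall fun ε => by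
    rw [add_sub_cancel_left, norm_pow, Complex.norm_real, Real.norm_of_nonneg (ρ.pos ε).le]
    exact ρ.pow_anti ε (by omega))
  have hw' : IsRep ρ (fun ε => x' ε + (ρ ε : ℂ) ^ K) c := hw.of_negligible_sub (by
    refine isNegligible_of_le fun m => ⟨1, ?_⟩
    filter_upwards [(hx'.negligible_sub hx).eventually_le m] with ε hε
    simpa using hε)
  have d1 := ((hF.2 c hc _ hw).negligible_sub (hF.2 c hc _ hw')).eventually_le (n + K)
  have d2 := ((hF.2 z hz _ hx).negligible_sub (hF.2 z hz _ hx')).eventually_le (n + K)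
  refine ⟨4, ?_⟩
  filter_upwards [h₁, h₂, d1, d2, ρ.eventually_le (δ := 1 / 2) (by norm_num)]
    with ε h₁ h₂ d1 d2 hρ
  have hp := ρ.pos ε
  have hK := pow_pos hp K
  have hlt : ∀ M, M + n < K → ρ ε ^ K < ρ ε ^ M ∧ (ρ ε ^ M)⁻¹ * ρ ε ^ K ≤ ρ ε ^ n := by
    intro M hM
    have hM' := pow_pos hp M
    constructor
    · exact pow_lt_pow_right_of_lt_one₀ hp (by linarith) (by omega)
    · rw [inv_mul_le_iff₀ hM', ← pow_add]
      exact ρ.pow_anti ε hM.le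
  have hn : ‖(ρ ε : ℂ) ^ K‖ = ρ ε ^ K := by
    rw [norm_pow, Complex.norm_real, Real.norm_of_nonneg hp.le]
  have ds : ∀ u : ℂ, dslope (f ε) u (u + (ρ ε : ℂ) ^ K) =
      ((ρ ε : ℂ) ^ K)⁻¹ * (f ε (u + (ρ ε : ℂ) ^ K) - f ε u) := by
    intro u
    have hne : (ρ ε : ℂ) ^ K ≠ 0 := pow_ne_zero _ (by exact_mod_cast hp.ne')
    rw [dslope_of_ne _ (by simpa using hne), slope_def_module]
    simp
  have t1 := h₁.2 (x ε + (ρ ε : ℂ) ^ K) (by simpa [hn] using (hlt N₁ (by omega)).1)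
  have t2 := h₂.2 (x' ε + (ρ ε : ℂ) ^ K) (by simpa [hn] using (hlt N₂ (by omega)).1)
  rw [add_sub_cancel_left, hn] at t1 t2
  have t1' := t1.trans (hlt N₁ (by omega)).2
  have t2' := t2.trans (hlt N₂ (by omega)).2
  have t3 : ‖dslope (f ε) (x ε) (x ε + (ρ ε : ℂ) ^ K) -
      dslope (f ε) (x' ε) (x' ε + (ρ ε : ℂ) ^ K)‖ ≤ 2 * ρ ε ^ n := by
    rw [ds, ds, ← mul_sub, norm_mul, norm_inv, hn, inv_mul_le_iff₀ hK]
    simp only [Pi.sub_apply] at d1 d2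
    calc _ = ‖(f ε (x ε + (ρ ε : ℂ) ^ K) - f ε (x' ε + (ρ ε : ℂ) ^ K)) -
          (f ε (x ε) - f ε (x' ε))‖ := by congr 1; ring
      _ ≤ ρ ε ^ (n + K) + ρ ε ^ (n + K) := (norm_sub_le _ _).trans (add_le_add d1 d2)
      _ = _ := by ring
  simp only [Pi.sub_apply]
  calc ‖deriv (f ε) (x ε) - deriv (f ε) (x' ε)‖
      = ‖(dslope (f ε) (x ε) (x ε + (ρ ε : ℂ) ^ K) -
          dslope (f ε) (x' ε) (x' ε + (ρ ε : ℂ) ^ K)) -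
          (dslope (f ε) (x ε) (x ε + (ρ ε : ℂ) ^ K) - deriv (f ε) (x ε)) +
          (dslope (f ε) (x' ε) (x' ε + (ρ ε : ℂ) ^ K) - deriv (f ε) (x' ε))‖ := by
        congr 1; ring
    _ ≤ 2 * ρ ε ^ n + ρ ε ^ n + ρ ε ^ n :=
        (norm_add_le _ _).trans (add_le_add ((norm_sub_le _ _).trans (add_le_add t3 t1')) t2')
    _ = _ := by ring

/-- A net of holomorphic functions that defines a basic function on a sharply open set is
differentiable with the strong little-oh in each direction. -/
theorem Defines.strongDiffOn (hU : IsSharplyOpen ρ U) (hA : ∀ ε, IsOpen (A ε))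
    (hf : ∀ ε, DifferentiableOn ℂ (f ε) (A ε)) (hF : Defines ρ U A f F) {v : ℂ} (hv : ‖v‖ = 1)
    (K : Set ℂ) {D : GenC ρ → GenC ρ}
    (hD : ∀ z ∈ U, ∀ x, IsRep ρ x z → IsRep ρ (fun ε => v * deriv (f ε) (x ε)) (D z)) :
    StrongDiffOn ρ K v U U F D A f := by
  set r : Idx → ℂ → ℂ → ℂ := fun ε x t => v * (dslope (f ε) x (x + v * t) - deriv (f ε) x) with hr
  have hQ : ∀ ε x y, y * r ε x y = f ε (x + v * y) - f ε x - y * (v * deriv (f ε) x) := by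
    intro ε x y
    have := sub_smul_dslope (f ε) x (x + v * y)
    rw [add_sub_cancel_left, smul_eq_mul] at this
    rw [← this, hr]
    ring
  have hsmall : ∀ z ∈ U, ∀ x, IsRep ρ x z → ∃ N : ℕ, ∀ᶠ ε in small, ∀ t, ‖t‖ < ρ ε ^ N →
      ‖r ε (x ε) t‖ ≤ (ρ ε ^ N)⁻¹ * ‖t‖ := by
    intro z hz x hx
    obtain ⟨N, hN⟩ := hF.exists_taylor_bound hU hf hz hx
    refine ⟨N, hN.mono fun ε hε t ht => ?_⟩
    have := hε.2 (x ε + v * t) (by simpa [hv] using ht)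
    simpa [hr, hv] using this
  have hQrep : ∀ z ∈ U, ∀ h, z + std ρ v * h ∈ U → ∀ x y, IsRep ρ x z → IsRep ρ y h →
      IsRep ρ (fun ε => y ε * r ε (x ε) (y ε)) (F (z + std ρ v * h) - F z - h * D z) := by
    intro z hz h hzh x y hx hy
    simp only [hQ]
    exact ((hF.2 _ hzh _ (hx.add ((isRep_std v).mul hy))).sub (hF.2 z hz x hx)).sub
      (hy.mul (hD z hz x hx))
  have hmod : ∀ z ∈ U, ∀ h, z + std ρ v * h ∈ U → ∀ x y, IsRep ρ x z → IsRep ρ y h →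
      IsModerate ρ fun ε => r ε (x ε) (y ε) := by
    intro z hz h hzh x y hx hy
    obtain ⟨N, hN⟩ := hsmall z hz x hx
    obtain ⟨M, hM⟩ := (hQrep z hz h hzh x y hx hy).moderate.exists_le
    refine isModerate_of_le 1 (M + N) ?_
    filter_upwards [hN, hM] with ε h1 h2
    have hpN := pow_pos (ρ.pos ε) N
    have hpM := pow_pos (ρ.pos ε) M
    rw [one_mul]
    rcases lt_or_ge ‖y ε‖ (ρ ε ^ N) with h3 | h3
    · refine (h1 _ h3).trans ?_
      rw [inv_mul_le_iff₀ hpN]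
      have : (1 : ℝ) ≤ (ρ ε ^ (M + N))⁻¹ :=
        (one_le_inv₀ (pow_pos (ρ.pos ε) _)).2 (pow_le_one₀ (ρ.pos ε).le (ρ.le_one ε))
      exact h3.le.trans (le_mul_of_one_le_right hpN.le this)
    · rw [norm_mul] at h2
      rw [pow_add, mul_inv, ← div_eq_mul_inv, le_div_iff₀ hpN, mul_comm]
      exact (mul_le_mul_of_nonneg_right h3 (norm_nonneg _)).trans h2
  have hrep : ∀ z ∈ U, ∀ h, z + std ρ v * h ∈ U → ∀ x y, IsRep ρ x z → IsRep ρ y h →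
      IsRep ρ (fun ε => r ε (x ε) (y ε)) (ofNet ρ fun ε => r ε (rep ρ z ε) (rep ρ h ε)) := by
    intro z hz h hzh x y hx hy
    have hx' := isRep_rep z
    have hy' := isRep_rep h
    set x' := rep ρ z
    set y' := rep ρ h
    have hm' := hmod z hz h hzh x' y' hx' hy'
    refine (isRep_ofNet hm').of_negligible_sub (isNegligible_of_le fun n => ?_)
    obtain ⟨N₁, h₁⟩ := hsmall z hz x hx
    obtain ⟨N₂, h₂⟩ := hsmall z hz x' hx'
    obtain ⟨M, hM⟩ := hm'.exists_le
    set L := N₁ + N₂ + n + 1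
    have d1 := ((hQrep z hz h hzh x y hx hy).negligible_sub
      (hQrep z hz h hzh x' y' hx' hy')).eventually_le (n + L)
    have d2 := (hy'.negligible_sub hy).eventually_le (n + L + M)
    refine ⟨3, ?_⟩
    filter_upwards [h₁, h₂, hM, d1, d2, ρ.eventually_le (δ := 1 / 4) (by norm_num)]
      with ε h₁ h₂ hM d1 d2 hρ
    simp only [Pi.sub_apply] at d1 d2 ⊢
    have hp := ρ.pos ε
    have hL := pow_pos hp L
    have hn := pow_pos hp n
    rcases le_or_gt ‖y ε‖ (ρ ε ^ L) with h3 | h3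
    · have hy2 : ‖y' ε‖ ≤ 2 * ρ ε ^ L := by
        have := norm_le_norm_add_norm_sub' (y' ε) (y ε)
        have := ρ.pow_anti ε (show L ≤ n + L + M by omega)
        linarith
      have hb : ∀ k, k + n < L → 2 * ρ ε ^ L < ρ ε ^ k ∧ (ρ ε ^ k)⁻¹ * ρ ε ^ L ≤ ρ ε ^ n := by
        intro k hk
        have hpk := pow_pos hp k
        constructor
        · have : ρ ε ^ L ≤ ρ ε ^ k * ρ ε := by
            rw [← pow_succ]; exact ρ.pow_anti ε (by omega)
          nlinarith
        · rw [inv_mul_le_iff₀ hpk, ← pow_add]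
          exact ρ.pow_anti ε hk.le
      have b1 := hb N₁ (by omega)
      have b2 := hb N₂ (by omega)
      have e1 := h₁ (y ε) (by linarith)
      have e2 := h₂ (y' ε) (by linarith)
      have e1' : ‖r ε (x ε) (y ε)‖ ≤ ρ ε ^ n :=
        e1.trans ((mul_le_mul_of_nonneg_left h3 (by positivity)).trans b1.2)
      have e2' : ‖r ε (x' ε) (y' ε)‖ ≤ 2 * ρ ε ^ n :=
        e2.trans ((mul_le_mul_of_nonneg_left hy2 (by positivity)).trans (by linarith [b2.2]))
      exact (norm_sub_le _ _).trans (by linarith)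
    · have hy0 : 0 < ‖y ε‖ := hL.trans h3
      have e : y ε * (r ε (x ε) (y ε) - r ε (x' ε) (y' ε)) =
          (y ε * r ε (x ε) (y ε) - y' ε * r ε (x' ε) (y' ε)) +
            (y' ε - y ε) * r ε (x' ε) (y' ε) := by ring
      have e1 : ‖(y' ε - y ε) * r ε (x' ε) (y' ε)‖ ≤ ρ ε ^ (n + L) := by
        rw [norm_mul]
        calc _ ≤ ρ ε ^ (n + L + M) * (ρ ε ^ M)⁻¹ := by gcongr
          _ = _ := by
            rw [pow_add _ (n + L), mul_inv_cancel_right₀ (pow_pos hp M).ne']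
      have e2 : ‖y ε‖ * ‖r ε (x ε) (y ε) - r ε (x' ε) (y' ε)‖ ≤ ‖y ε‖ * (2 * ρ ε ^ n) := by
        rw [← norm_mul, e]
        calc _ ≤ ρ ε ^ (n + L) + ρ ε ^ (n + L) := (norm_add_le _ _).trans (add_le_add d1 e1)
          _ = ρ ε ^ L * (2 * ρ ε ^ n) := by ring
          _ ≤ _ := by gcongr
      have := le_of_mul_le_mul_left e2 hy0
      linarith
  refine ⟨hF, Set.univ, r, fun z h => ofNet ρ fun ε => r ε (rep ρ z ε) (rep ρ h ε), ?_,
    fun z hz h _ hzh x y hx hy _ => hrep z hz h hzh x y hx hy, fun z hz => ⟨fun q => ?_, ?_⟩⟩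
  · intro z hz
    obtain ⟨s, hs, hsU⟩ := hU z hz
    refine ⟨s, hs, fun h y hy _ hlt => ⟨trivial, hsU ?_⟩⟩
    obtain ⟨w, hw⟩ := exists_rep ρ s
    have hx := isRep_rep z
    obtain ⟨N, hN⟩ := (lt_iff hy.modulus hw).1 hlt
    exact (mem_ball_iff hx (hx.add ((isRep_std v).mul hy)) hw).2 ⟨N, by simpa [hv] using hN⟩
  · obtain ⟨N, hN⟩ := hsmall z hz _ (isRep_rep z)
    refine ⟨dρ ρ (N + q + 1 : ℕ), dρ_pos (Nat.cast_nonneg _), fun h _ hzh _ _ hlt => ?_⟩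
    have hy := isRep_rep h
    obtain ⟨M, hM⟩ := (lt_iff hy.modulus (isRep_dρ_nat _)).1 hlt
    refine (lt_iff (hrep z hz h hzh _ _ (isRep_rep z) hy).modulus (isRep_dρ_nat q)).2
      ⟨q + 1, ?_⟩
    filter_upwards [hN, hM, ρ.eventually_mul_pow_le 2 q.lt_succ_self] with ε h1 h2 h3
    rw [Nat.succ_eq_add_one] at h3
    have hp := ρ.pos ε
    have hpN := pow_pos hp N
    have hpM := pow_pos hp M
    have hlt : ‖rep ρ h ε‖ < ρ ε ^ (N + q + 1) := by linarith
    have h4 := h1 _ (hlt.trans_le (ρ.pow_anti ε (by omega)))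
    have h5 : (ρ ε ^ N)⁻¹ * ‖rep ρ h ε‖ ≤ ρ ε ^ (q + 1) := by
      rw [inv_mul_le_iff₀ hpN, ← pow_add]
      exact hlt.le
    linarith
  · intro x hx
    refine ⟨_, hD z hz x hx, fun h _ hzh y hy _ => ?_⟩
    filter_upwards [hF.1 hz x hx] with ε hε
    refine ⟨by rw [hQ]; ring, by simp [hr], ?_⟩
    have hd : DifferentiableAt ℂ (f ε) (x ε) := (hf ε).differentiableAt ((hA ε).mem_nhds hε)
    have hc : ContinuousAt (dslope (f ε) (x ε)) (x ε) := continuousAt_dslope_same.2 hd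
    have hc' : ContinuousAt (fun t => r ε (x ε) t) 0 := by
      have h0 : ContinuousAt (fun t : ℂ => x ε + v * t) 0 := by fun_prop
      have : ContinuousAt (dslope (f ε) (x ε)) (x ε + v * 0) := by simpa using hc
      have h2 : ContinuousAt (fun t : ℂ => dslope (f ε) (x ε) (x ε + v * t)) 0 :=
        ContinuousAt.comp this h0
      exact continuousAt_const.mul (h2.sub continuousAt_const)
    have h0 : r ε (x ε) 0 = 0 := by simp [hr]
    have := hc'.tendsto
    rw [h0] at this
    exact this.mono_left nhdsWithin_le_nhds

end Nets

/-! ### Convolution with the scaled mollifier -/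

section Conv

variable {ρ : Gauge} {Ω : Opens ℂ} {k : 𝓓(Ω, ℂ)}

theorem conv_congr (k : ℂ → ℂ) {f g : ℂ → ℂ} (h : f =ᵐ[volume.restrict Ω] g) :
    conv ρ Ω k f = conv ρ Ω k g := by
  funext ε z
  exact integral_congr_ae (h.mono fun ζ hζ => by simp only [hζ])

theorem conv_const_mul (k f : ℂ → ℂ) (c : ℂ) (ε : Idx) (z : ℂ) :
    conv ρ Ω k (fun ζ => c * f ζ) ε z = c * conv ρ Ω k f ε z := by
  simp only [conv, mul_assoc]
  exact integral_const_mul _ _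

theorem Gauge.ofReal_ne_zero (ρ : Gauge) (ε : Idx) : (ρ ε : ℂ) ≠ 0 :=
  Complex.ofReal_ne_zero.2 (ρ.pos ε).ne'

theorem mem_tsupport_scaled_iff (k : ℂ → ℂ) (ε : Idx) (z : ℂ) :
    z ∈ tsupport (scaled ρ k ε) ↔ (ρ ε : ℂ)⁻¹ * z ∈ tsupport k := by
  have h0 := ρ.ofReal_ne_zero ε
  have h1 : Function.support (scaled ρ k ε) =
      Homeomorph.mulLeft₀ (ρ ε : ℂ)⁻¹ (inv_ne_zero h0) ⁻¹' Function.support k := by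
    ext w
    simp [scaled, h0]
  rw [tsupport, h1, ← Homeomorph.preimage_closure]
  rfl

theorem mem_convDom_iff {k : ℂ → ℂ} {ε : Idx} {z : ℂ} :
    z ∈ convDom ρ Ω k ε ↔ z ∈ Ω ∧ ∀ w ∈ tsupport k, z - ρ ε * w ∈ Ω := by
  have h0 := ρ.ofReal_ne_zero ε
  refine and_congr_right fun _ => ⟨fun h w hw => h _ ?_, fun h w hw => ?_⟩
  · rwa [mem_tsupport_scaled_iff, inv_mul_cancel_left₀ h0]
  · simpa [mul_inv_cancel_left₀ h0] using h _ ((mem_tsupport_scaled_iff k ε w).1 hw)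

theorem conv_eq_integral {k : ℂ → ℂ} (f : ℂ → ℂ) {ε : Idx} {z : ℂ} (hz : z ∈ convDom ρ Ω k ε) :
    conv ρ Ω k f ε z = ∫ w, f (z - ρ ε * w) * k w := by
  have h0 := ρ.ofReal_ne_zero ε
  rw [conv, setIntegral_eq_integral_of_forall_compl_eq_zero]
  · rw [← integral_sub_left_eq_self (fun ζ => f ζ * scaled ρ k ε (z - ζ)) volume z]
    have h1 := Measure.integral_comp_inv_smul_of_nonneg (volume : Measure ℂ)
      (fun w => ((ρ ε : ℂ) ^ 2)⁻¹ * (f (z - ρ ε * w) * k w)) (ρ.pos ε).le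
    rw [Complex.finrank_real_complex] at h1
    simp only [Complex.real_smul, Complex.ofReal_inv, Complex.ofReal_pow,
      mul_inv_cancel_left₀ h0, integral_const_mul, mul_inv_cancel_left₀ (pow_ne_zero 2 h0)] at h1
    rw [← h1, ← integral_const_mul]
    refine integral_congr_ae (Eventually.of_forall fun w => ?_)
    simp only [scaled, sub_sub_cancel]
    ring
  · intro ζ hζ
    have : z - ζ ∉ tsupport (scaled ρ k ε) := fun h => hζ (by simpa using hz.2 _ h)
    rw [image_eq_zero_of_notMem_tsupport this, mul_zero]

/-- A neighbourhood of a point of the domain on which the translates of the support stay in a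
compact subset of `Ω`. -/
theorem exists_compact_of_mem_convDom (k : 𝓓(Ω, ℂ)) {ε : Idx} {z : ℂ}
    (hz : z ∈ convDom ρ Ω k ε) :
    ∃ δ > 0, ∃ L : Set ℂ, IsCompact L ∧ L ⊆ Ω ∧ Metric.ball z δ ⊆ convDom ρ Ω k ε ∧
      ∀ x ∈ Metric.ball z δ, ∀ w ∈ tsupport k, x - ρ ε * w ∈ L := by
  obtain ⟨hzΩ, hz⟩ := mem_convDom_iff.1 hz
  have hK : IsCompact ((fun w => z - ρ ε * w) '' tsupport k) :=
    k.hasCompactSupport.isCompact.image (by fun_prop)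
  obtain ⟨δ, hδ, hsub⟩ := hK.exists_cthickening_subset_open Ω.isOpen
    (by rintro _ ⟨w, hw, rfl⟩; exact hz w hw)
  obtain ⟨δ', hδ', hsub'⟩ := Metric.isOpen_iff.1 Ω.isOpen z hzΩ
  have hmem : ∀ x ∈ Metric.ball z (min δ δ'), ∀ w ∈ tsupport k,
      x - ρ ε * w ∈ Metric.cthickening δ ((fun w => z - ρ ε * w) '' tsupport k) := by
    intro x hx w hw
    refine Metric.mem_cthickening_of_dist_le _ (z - ρ ε * w) _ _ ⟨w, hw, rfl⟩ ?_
    rw [dist_sub_right]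
    exact (Metric.mem_ball.1 hx).le.trans (min_le_left _ _)
  exact ⟨min δ δ', lt_min hδ hδ', _, hK.cthickening, hsub,
    fun x hx => mem_convDom_iff.2 ⟨hsub' (Metric.ball_subset_ball (min_le_right _ _) hx),
      fun w hw => hsub (hmem x hx w hw)⟩, hmem⟩

theorem isOpen_convDom (k : 𝓓(Ω, ℂ)) (ε : Idx) : IsOpen (convDom ρ Ω k ε) := by
  refine Metric.isOpen_iff.2 fun z hz => ?_
  obtain ⟨δ, hδ, L, _, _, h, _⟩ := exists_compact_of_mem_convDom k hz
  exact ⟨δ, hδ, h⟩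

theorem continuous_comp_mul (k : 𝓓(Ω, ℂ)) {G : ℂ → ℂ} (hG : ContinuousOn G Ω) {ε : Idx} {z : ℂ}
    (hz : z ∈ convDom ρ Ω k ε) : Continuous fun w => G (z - ρ ε * w) * k w := by
  have hc : Continuous fun w : ℂ => z - ρ ε * w := by fun_prop
  refine ContinuousOn.continuous_of_tsupport_subset
    (s := (fun w : ℂ => z - ρ ε * w) ⁻¹' Ω) ?_ (Ω.isOpen.preimage hc) ?_
  · exact (hG.comp hc.continuousOn fun w hw => hw).mul k.continuous.continuousOn
  · exact (tsupport_mul_subset_right).trans fun w hw => (mem_convDom_iff.1 hz).2 w hw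

theorem integrable_comp_mul (k : 𝓓(Ω, ℂ)) {G : ℂ → ℂ} (hG : ContinuousOn G Ω) {ε : Idx} {z : ℂ}
    (hz : z ∈ convDom ρ Ω k ε) : Integrable fun w => G (z - ρ ε * w) * k w :=
  (continuous_comp_mul k hG hz).integrable_of_hasCompactSupport k.hasCompactSupport.mul_left

theorem integrable_coe (k : 𝓓(Ω, ℂ)) : Integrable k :=
  k.continuous.integrable_of_hasCompactSupport k.hasCompactSupport

theorem hasDerivAt_conv (k : 𝓓(Ω, ℂ)) {F : ℂ → ℂ} (hF : DifferentiableOn ℂ F Ω) {ε : Idx} {z : ℂ}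
    (hz : z ∈ convDom ρ Ω k ε) :
    HasDerivAt (conv ρ Ω k F ε) (conv ρ Ω k (deriv F) ε z) z := by
  obtain ⟨δ, hδ, L, hL, hLΩ, hball, hmem⟩ := exists_compact_of_mem_convDom k hz
  have hF' : ContinuousOn (deriv F) Ω := (hF.deriv Ω.isOpen).continuousOn
  obtain ⟨M, hM⟩ := hL.exists_bound_of_continuousOn (hF'.mono hLΩ)
  have hnhds := Metric.ball_mem_nhds z hδ
  have key := (hasDerivAt_integral_of_dominated_loc_of_deriv_le (𝕜 := ℂ) (μ := volume)
    (F := fun x w => F (x - ρ ε * w) * k w) (F' := fun x w => deriv F (x - ρ ε * w) * k w)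
    (bound := fun w => M * ‖k w‖) (x₀ := z) hnhds
    (eventually_of_mem hnhds fun x hx =>
      (continuous_comp_mul k hF.continuousOn (hball hx)).aestronglyMeasurable)
    (integrable_comp_mul k hF.continuousOn hz)
    (continuous_comp_mul k hF' hz).aestronglyMeasurable
    (Eventually.of_forall fun w x hx => ?_) ((integrable_coe k).norm.const_mul M)
    (Eventually.of_forall fun w x hx => ?_)).2
  · rw [conv_eq_integral _ hz]
    refine key.congr_of_eventuallyEq (eventually_of_mem hnhds fun x hx => ?_)
    exact conv_eq_integral _ (hball hx)
  · by_cases hw : w ∈ tsupport k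
    · rw [norm_mul]
      exact mul_le_mul_of_nonneg_right (hM _ (hmem x hx w hw)) (norm_nonneg _)
    · simp [image_eq_zero_of_notMem_tsupport hw]
  · by_cases hw : w ∈ tsupport k
    · have h1 := (hF.differentiableAt (Ω.isOpen.mem_nhds (hLΩ (hmem x hx w hw)))).hasDerivAt
      exact (h1.comp_sub_const x (ρ ε * w)).mul_const (k w)
    · simpa [image_eq_zero_of_notMem_tsupport hw] using hasDerivAt_const x (0 : ℂ)

theorem differentiableOn_conv (k : 𝓓(Ω, ℂ)) {F : ℂ → ℂ} (hF : DifferentiableOn ℂ F Ω) (ε : Idx) :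
    DifferentiableOn ℂ (conv ρ Ω k F ε) (convDom ρ Ω k ε) := fun _ hz =>
  (hasDerivAt_conv k hF hz).differentiableAt.differentiableWithinAt

/-- Points close to `z` are eventually moved only slightly by the support of the mollifier. -/
theorem exists_eventually_mem_convDom (ρ : Gauge) (k : 𝓓(Ω, ℂ)) {z : ℂ} {r : ℝ} (hr : 0 < r)
    (hz : Metric.closedBall z r ⊆ Ω) :
    ∃ δ > 0, ∀ᶠ ε in small, ∀ y ∈ Metric.ball z δ, y ∈ convDom ρ Ω k ε ∧
      ∀ w ∈ tsupport k, y - ρ ε * w ∈ Metric.closedBall z r := by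
  obtain ⟨C, hC⟩ := k.hasCompactSupport.isCompact.isBounded.exists_norm_le
  refine ⟨r / 2, by positivity, ?_⟩
  filter_upwards [ρ.eventually_le (δ := r / 2 / (|C| + 1)) (by positivity)] with ε hε y hy
  have hmem : ∀ w ∈ tsupport k, y - ρ ε * w ∈ Metric.closedBall z r := by
    intro w hw
    rw [mem_ball_iff_norm] at hy
    rw [mem_closedBall_iff_norm]
    have h1 : ‖(ρ ε : ℂ) * w‖ ≤ r / 2 := by
      rw [norm_mul, Complex.norm_real, Real.norm_of_nonneg (ρ.pos ε).le]
      calc ρ ε * ‖w‖ ≤ r / 2 / (|C| + 1) * (|C| + 1) := by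
            gcongr
            linarith [hC w hw, le_abs_self C]
        _ = r / 2 := by field_simp
    calc ‖y - ρ ε * w - z‖ = ‖(y - z) - ρ ε * w‖ := by congr 1; ring
      _ ≤ ‖y - z‖ + ‖(ρ ε : ℂ) * w‖ := norm_sub_le _ _
      _ ≤ r := by linarith
  refine ⟨mem_convDom_iff.2 ⟨hz ?_, fun w hw => hz (hmem w hw)⟩, hmem⟩
  exact Metric.ball_subset_closedBall (Metric.ball_subset_ball (by linarith) hy)

theorem exists_conv_bound (ρ : Gauge) (k : 𝓓(Ω, ℂ)) {G : ℂ → ℂ} (hG : ContinuousOn G Ω) {z : ℂ}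
    (hz : z ∈ Ω) : ∃ δ > 0, ∃ M : ℝ, ∀ᶠ ε in small, ∀ y ∈ Metric.ball z δ,
      y ∈ convDom ρ Ω k ε ∧ ‖conv ρ Ω k G ε y‖ ≤ M := by
  obtain ⟨r, hr, hsub⟩ := Metric.nhds_basis_closedBall.mem_iff.1 (Ω.isOpen.mem_nhds hz)
  obtain ⟨M, hM⟩ := (isCompact_closedBall z r).exists_bound_of_continuousOn (hG.mono hsub)
  obtain ⟨δ, hδ, h⟩ := exists_eventually_mem_convDom ρ k hr hsub
  refine ⟨δ, hδ, ∫ w, M * ‖k w‖, h.mono fun ε hε y hy => ⟨(hε y hy).1, ?_⟩⟩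
  rw [conv_eq_integral _ (hε y hy).1]
  refine norm_integral_le_of_norm_le ((integrable_coe k).norm.const_mul M)
    (Eventually.of_forall fun w => ?_)
  by_cases hw : w ∈ tsupport k
  · rw [norm_mul]
    exact mul_le_mul_of_nonneg_right (hM _ ((hε y hy).2 w hw)) (norm_nonneg _)
  · simp [image_eq_zero_of_notMem_tsupport hw]

theorem tendsto_conv (ρ : Gauge) (k : 𝓓(Ω, ℂ)) (hk : ∫ z, k z = 1) {G : ℂ → ℂ}
    (hG : ContinuousOn G Ω) {z : ℂ} (hz : z ∈ Ω) :
    Tendsto (fun ε => conv ρ Ω k G ε z) small (𝓝 (G z)) := by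
  refine Metric.tendsto_nhds.2 fun η hη => ?_
  set I := ∫ w, ‖k w‖
  have hI : 0 ≤ I := integral_nonneg fun w => norm_nonneg _
  have hη' : 0 < η / (I + 1) := by positivity
  have hc := (hG.continuousAt (Ω.isOpen.mem_nhds hz)).eventually
    (Metric.ball_mem_nhds (G z) hη')
  obtain ⟨r, hr, hsub⟩ := Metric.nhds_basis_closedBall.mem_iff.1
    (Filter.inter_mem (Ω.isOpen.mem_nhds hz) hc)
  obtain ⟨δ, hδ, h⟩ := exists_eventually_mem_convDom ρ k hr fun w hw => (hsub hw).1
  refine h.mono fun ε hε => ?_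
  obtain ⟨h1, h2⟩ := hε z (Metric.mem_ball_self hδ)
  rw [dist_eq_norm, conv_eq_integral _ h1]
  have e : (∫ w, G (z - ρ ε * w) * k w) - G z = ∫ w, (G (z - ρ ε * w) - G z) * k w := by
    simp only [sub_mul]
    rw [integral_sub (integrable_comp_mul k hG h1) ((integrable_coe k).const_mul _),
      integral_const_mul, hk, mul_one]
  rw [e]
  calc _ ≤ ∫ w, η / (I + 1) * ‖k w‖ := by
        refine norm_integral_le_of_norm_le ((integrable_coe k).norm.const_mul _)
          (Eventually.of_forall fun w => ?_)
        by_cases hw : w ∈ tsupport k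
        · rw [norm_mul, ← dist_eq_norm]
          exact mul_le_mul_of_nonneg_right (Metric.mem_ball.1 (hsub (h2 w hw)).2).le
            (norm_nonneg _)
        · simp [image_eq_zero_of_notMem_tsupport hw]
    _ = η / (I + 1) * I := integral_const_mul _ _
    _ < η := by
        rw [div_mul_eq_mul_div, div_lt_iff₀ (by positivity)]
        nlinarith

end Conv

/-! ### The embedding of holomorphic functions -/

section Emb

variable {ρ : Gauge} {Ω : Opens ℂ}

theorem emb_congr (k : ℂ → ℂ) {f g : ℂ → ℂ} (h : f =ᵐ[volume.restrict Ω] g) :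
    emb ρ Ω k f = emb ρ Ω k g := by
  unfold emb
  rw [conv_congr k h]

theorem embDom_congr (k : ℂ → ℂ) {f g : ℂ → ℂ} (h : f =ᵐ[volume.restrict Ω] g) :
    embDom ρ Ω k f = embDom ρ Ω k g := by
  unfold embDom
  rw [conv_congr k h]

theorem defines_emb (k f : ℂ → ℂ) :
    Defines ρ (embDom ρ Ω k f) (fun _ => (Ω : Set ℂ)) (conv ρ Ω k f) (emb ρ Ω k f) := by
  refine ⟨fun z ⟨q, hq, x, hx, h1, _⟩ => h1 (mem_ball_self hq.le z), ?_⟩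
  rintro z ⟨q, hq, x, hx, h1, h2, ⟨F, hF⟩, h4⟩ y hy
  have hz := mem_ball_self hq.le z
  rw [emb, (hF.2 z hz _ (isRep_rep z)).ofNet_eq]
  exact hF.2 z hz y hy

theorem isSharplyOpen_embDom (k f : ℂ → ℂ) : IsSharplyOpen ρ (embDom ρ Ω k f) := by
  rintro z ⟨q, hq, x, hx, h1, h2, ⟨F, hF⟩, h4⟩
  refine ⟨_, dρ_pos hq.le, fun c hc => ?_⟩
  have hy := isRep_rep c
  obtain ⟨p, hp, hsub, hball⟩ := exists_ball_subset_ball hq hx hy hc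
  refine ⟨p, by exact_mod_cast hp, _, hy, hsub.trans h1, ?_,
    ⟨F, hsub.trans hF.1, fun w hw => hF.2 w (hsub hw)⟩, fun w hw => h4 w (hsub hw)⟩
  filter_upwards [h2, hball] with ε h2 h3
  rw [Real.rpow_natCast]
  exact ⟨h3.trans h2.1, h2.2.mono h3⟩

theorem embDom_subset_sint (k f : ℂ → ℂ) : embDom ρ Ω k f ⊆ sint ρ (convDom ρ Ω k) := by
  rintro z ⟨q, hq, x, hx, h1, h2, _⟩ y hy
  obtain ⟨p, _, _, hball⟩ := exists_ball_subset_ball hq hx hy (mem_ball_self hq.le z)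
  filter_upwards [h2, hball] with ε h2 h3
  exact h2.1 (h3 (Metric.mem_ball_self (pow_pos (ρ.pos ε) p)))

theorem Defines.mono_domain {U : Set (GenC ρ)} {A B : Idx → Set ℂ} {f : Idx → ℂ → ℂ}
    {F : GenC ρ → GenC ρ} (h : Defines ρ U A f F) (hB : U ⊆ sint ρ B) : Defines ρ U B f F :=
  ⟨hB, h.2⟩

theorem std_mem_embDom (k : 𝓓(Ω, ℂ)) {F : ℂ → ℂ} (hF : DifferentiableOn ℂ F Ω) {z : ℂ}
    (hz : z ∈ Ω) : std ρ z ∈ embDom ρ Ω k F := by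
  have hF' : ContinuousOn (deriv F) Ω := (hF.deriv Ω.isOpen).continuousOn
  obtain ⟨δ₁, hδ₁, M₁, h₁⟩ := exists_conv_bound ρ k hF.continuousOn hz
  obtain ⟨δ₂, hδ₂, M₂, h₂⟩ := exists_conv_bound ρ k hF' hz
  set δ := min δ₁ δ₂
  have hδ : 0 < δ := lt_min hδ₁ hδ₂
  have hb : ∀ᶠ ε in small, ∀ y ∈ Metric.ball z δ, y ∈ convDom ρ Ω k ε ∧
      ‖conv ρ Ω k F ε y‖ ≤ M₁ ∧ ‖deriv (conv ρ Ω k F ε) y‖ ≤ M₂ := by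
    filter_upwards [h₁, h₂] with ε h₁ h₂ y hy
    have a := h₁ y (Metric.ball_subset_ball (min_le_left _ _) hy)
    have b := h₂ y (Metric.ball_subset_ball (min_le_right _ _) hy)
    exact ⟨a.1, a.2, by rw [(hasDerivAt_conv k hF a.1).deriv]; exact b.2⟩
  have hmem : ∀ c ∈ ball ρ (std ρ z) (dρ ρ 1), ∀ y, IsRep ρ y c →
      ∀ᶠ ε in small, y ε ∈ Metric.ball z δ := by
    intro c hc y hy
    obtain ⟨N, hN⟩ := (mem_ball_iff (isRep_std z) hy (isRep_dρ zero_le_one)).1 hc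
    filter_upwards [hN, ρ.eventually_le hδ] with ε h1 h2
    have := pow_pos (ρ.pos ε) N
    rw [Real.rpow_one] at h1
    exact mem_ball_iff_norm.2 (by linarith)
  have hmod : ∀ c ∈ ball ρ (std ρ z) (dρ ρ 1), ∀ y, IsRep ρ y c →
      IsModerate ρ fun ε => conv ρ Ω k F ε (y ε) := by
    intro c hc y hy
    refine isModerate_of_le M₁ 0 ?_
    filter_upwards [hb, hmem c hc y hy] with ε h1 h2
    simpa using (h1 _ h2).2.1
  have hsint : ball ρ (std ρ z) (dρ ρ 1) ⊆ sint ρ fun _ => (Ω : Set ℂ) := by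
    intro c hc y hy
    filter_upwards [hb, hmem c hc y hy] with ε h1 h2
    exact (h1 _ h2).1.1
  refine ⟨1, one_pos, _, isRep_std z, hsint, ?_,
    ⟨fun c => ofNet ρ fun ε => conv ρ Ω k F ε (rep ρ c ε), hsint, fun c hc y hy => ?_⟩,
    fun c hc y hy => ?_⟩
  · filter_upwards [hb, ρ.eventually_le hδ] with ε h1 h2
    have hsub : Metric.ball z (ρ ε ^ (1 : ℝ)) ⊆ Metric.ball z δ :=
      Metric.ball_subset_ball (by rwa [Real.rpow_one])
    have : Metric.ball z (ρ ε ^ (1 : ℝ)) ⊆ convDom ρ Ω k ε := fun y hy => (h1 y (hsub hy)).1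
    exact ⟨this, (differentiableOn_conv k hF ε).mono this⟩
  · refine (isRep_ofNet (hmod c hc _ (isRep_rep c))).of_negligible_sub
      (isNegligible_of_le fun N => ⟨M₂, ?_⟩)
    filter_upwards [hb, hmem c hc y hy, hmem c hc _ (isRep_rep c),
      (hy.negligible_sub (isRep_rep c)).eventually_le N] with ε h1 h2 h3 h4
    have hM : 0 ≤ M₂ := (norm_nonneg _).trans (h1 _ h2).2.2
    exact ((convex_ball z δ).norm_image_sub_le_of_norm_deriv_le
      (fun u hu => (hasDerivAt_conv k hF (h1 u hu).1).differentiableAt)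
      (fun u hu => (h1 u hu).2.2) h3 h2).trans (mul_le_mul_of_nonneg_left h4 hM)
  · refine isModerate_of_le M₂ 0 ?_
    filter_upwards [hb, hmem c hc y hy] with ε h1 h2
    simpa using (h1 _ h2).2.2

theorem isRep_emb_std (k : 𝓓(Ω, ℂ)) {F : ℂ → ℂ} (hF : DifferentiableOn ℂ F Ω) {z : ℂ}
    (hz : z ∈ Ω) : IsRep ρ (fun ε => conv ρ Ω k F ε z) (emb ρ Ω k F (std ρ z)) :=
  (defines_emb k F).2 _ (std_mem_embDom k hF hz) _ (isRep_std z)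

theorem IsRep.tendsto_congr {x y : Idx → ℂ} {a : GenC ρ} {c : ℂ} (hx : IsRep ρ x a)
    (hy : IsRep ρ y a) (h : Tendsto x small (𝓝 c)) : Tendsto y small (𝓝 c) := by
  have h0 : Tendsto (y - x) small (𝓝 0) := by
    refine squeeze_zero_norm' ((hy.negligible_sub hx).eventually_le 1) ?_
    simpa using ρ.tendsto
  simpa using h0.add h

/-- Convolution commutes with the derivative of a holomorphic function. -/
theorem Defines.conv_deriv (k : 𝓓(Ω, ℂ)) {F : ℂ → ℂ} (hF : DifferentiableOn ℂ F Ω) (c : ℂ)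
    {U : Set (GenC ρ)} (hU : IsSharplyOpen ρ U) {G : GenC ρ → GenC ρ}
    (hG : Defines ρ U (convDom ρ Ω k) (conv ρ Ω k F) G) :
    ∃ H, Defines ρ U (convDom ρ Ω k) (conv ρ Ω k fun z => c * deriv F z) H := by
  obtain ⟨D, hD⟩ := hG.exists_deriv hU (differentiableOn_conv k hF)
  refine ⟨fun z => std ρ c * D z, hG.1, fun z hz x hx => ?_⟩
  refine ((isRep_std c).mul (hD.2 z hz x hx)).of_eventuallyEq ?_
  filter_upwards [hG.1 hz x hx] with ε hε
  rw [conv_const_mul, (hasDerivAt_conv k hF hε).deriv]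

theorem embDom_subset_embDom_deriv (k : 𝓓(Ω, ℂ)) {F : ℂ → ℂ} (hF : DifferentiableOn ℂ F Ω)
    (c : ℂ) : embDom ρ Ω k F ⊆ embDom ρ Ω k fun z => c * deriv F z := by
  rintro z ⟨q, hq, x, hx, h1, h2, ⟨G, hG⟩, h4⟩
  have hdF : DifferentiableOn ℂ (fun z => c * deriv F z) Ω := (hF.deriv Ω.isOpen).const_mul c
  have hopen := isSharplyOpen_ball hq z
  have hsint : ball ρ z (dρ ρ q) ⊆ sint ρ (convDom ρ Ω k) := by
    intro w hw y hy
    obtain ⟨p, _, _, hball⟩ := exists_ball_subset_ball hq hx hy hw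
    filter_upwards [h2, hball] with ε h2 h3
    exact h2.1 (h3 (Metric.mem_ball_self (pow_pos (ρ.pos ε) p)))
  obtain ⟨H, hH⟩ := (hG.mono_domain hsint).conv_deriv k hF c hopen
  obtain ⟨D, hD⟩ := hH.exists_deriv hopen (differentiableOn_conv k hdF)
  exact ⟨q, hq, x, hx, h1, h2.mono fun ε h => ⟨h.1, (differentiableOn_conv k hdF ε).mono h.1⟩,
    ⟨H, hH.mono_domain h1⟩, fun w hw y hy => (hD.2 w hw y hy).moderate⟩

theorem strongDiffOn_emb (k : 𝓓(Ω, ℂ)) {F : ℂ → ℂ} (hF : DifferentiableOn ℂ F Ω) {v : ℂ}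
    (hv : ‖v‖ = 1) (K : Set ℂ) {U : Set (GenC ρ)} (hU : IsSharplyOpen ρ U)
    (hUF : U ⊆ embDom ρ Ω k F) :
    StrongDiffOn ρ K v U U (emb ρ Ω k F) (emb ρ Ω k fun z => v * deriv F z) (convDom ρ Ω k)
      (conv ρ Ω k F) := by
  have hsint := hUF.trans (embDom_subset_sint (k : ℂ → ℂ) F)
  refine Defines.strongDiffOn hU (isOpen_convDom k) (differentiableOn_conv k hF)
    ⟨hsint, fun z hz => (defines_emb k F).2 z (hUF hz)⟩ hv K fun z hz x hx => ?_
  refine ((defines_emb k _).2 z (embDom_subset_embDom_deriv k hF v (hUF hz)) x hx).of_eventuallyEq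
    ?_
  filter_upwards [hsint hz x hx] with ε hε
  rw [conv_const_mul, (hasDerivAt_conv k hF hε).deriv]

theorem isGHF_emb (k : 𝓓(Ω, ℂ)) {F : ℂ → ℂ} (hF : DifferentiableOn ℂ F Ω)
    (hΩ : (Ω : Set ℂ).Nonempty) : IsGHF ρ (embDom ρ Ω k F) (emb ρ Ω k F) := by
  obtain ⟨z, hz⟩ := hΩ
  exact ⟨⟨_, std_mem_embDom k hF hz⟩, isSharplyOpen_embDom k F, convDom ρ Ω k, conv ρ Ω k F, _,
    fun ε => ⟨isOpen_convDom k ε, differentiableOn_conv k hF ε⟩,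
    strongDiffOn_emb k hF norm_one _ (isSharplyOpen_embDom k F) subset_rfl⟩

theorem isPartialDeriv_emb (k : 𝓓(Ω, ℂ)) {F : ℂ → ℂ} (hF : DifferentiableOn ℂ F Ω) {v : ℂ}
    (hv : ‖v‖ = 1) {U : Set (GenC ρ)} (hU : IsSharplyOpen ρ U) (hUF : U ⊆ embDom ρ Ω k F) :
    IsPartialDeriv ρ v U (emb ρ Ω k F) (emb ρ Ω k fun z => v * deriv F z) := by
  refine ⟨hU, convDom ρ Ω k, conv ρ Ω k F, fun ε => ⟨isOpen_convDom k ε, fun z hz => ?_⟩,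
    strongDiffOn_emb k hF hv _ hU hUF⟩
  have h := (hasDerivAt_conv k hF hz).differentiableAt.restrictScalars ℝ
  exact ⟨h.lineDifferentiableAt, h.lineDifferentiableAt⟩

end Emb

/-! ### A smooth radial mollifier in the image of the Cauchy-Riemann operator -/

/-- A smooth step from `0` on `(-∞, 1/2]` to `1` on `[1, ∞)`. -/
def smoothStep (u : ℝ) : ℝ := Real.smoothTransition (2 * u - 1)

theorem contDiff_smoothStep : ContDiff ℝ ∞ smoothStep :=
  Real.smoothTransition.contDiff.comp ((contDiff_const.mul contDiff_id).sub contDiff_const)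

theorem smoothStep_of_le {u : ℝ} (hu : u ≤ 1 / 2) : smoothStep u = 0 :=
  Real.smoothTransition.zero_of_nonpos (by linarith)

theorem smoothStep_of_ge {u : ℝ} (hu : 1 ≤ u) : smoothStep u = 1 :=
  Real.smoothTransition.one_of_one_le (by linarith)

theorem monotone_smoothStep : Monotone smoothStep := fun _ _ h =>
  Real.smoothTransition.monotone (by linarith)

theorem contDiff_deriv_smoothStep : ContDiff ℝ ∞ (deriv smoothStep) :=
  (contDiff_infty_iff_deriv.1 contDiff_smoothStep).2

theorem deriv_smoothStep_of_gt {u : ℝ} (hu : 1 < u) : deriv smoothStep u = 0 := by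
  have : smoothStep =ᶠ[𝓝 u] fun _ => 1 :=
    (eventually_gt_nhds hu).mono fun v hv => smoothStep_of_ge (le_of_lt hv)
  rw [this.deriv_eq, deriv_const]

theorem deriv_smoothStep_of_lt {u : ℝ} (hu : u < 1 / 2) : deriv smoothStep u = 0 := by
  have : smoothStep =ᶠ[𝓝 u] fun _ => 0 :=
    (eventually_lt_nhds hu).mono fun v hv => smoothStep_of_le (le_of_lt hv)
  rw [this.deriv_eq, deriv_const]

/-- The Cauchy kernel `1 / w`, smoothly cut off near the origin. -/
def cutCauchy (s : ℝ) (w : ℂ) : ℂ := (smoothStep (‖w‖ ^ 2 / s ^ 2) : ℂ) * w⁻¹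

/-- The image of the cut off Cauchy kernel under the Cauchy-Riemann operator. -/
def radialBump (s : ℝ) (w : ℂ) : ℝ := 2 / s ^ 2 * deriv smoothStep (‖w‖ ^ 2 / s ^ 2)

theorem contDiff_sq_div (s : ℝ) : ContDiff ℝ ∞ fun w : ℂ => ‖w‖ ^ 2 / s ^ 2 :=
  (contDiff_norm_sq ℝ).div_const _

theorem cutCauchy_eventuallyEq_zero (s : ℝ) : cutCauchy s =ᶠ[𝓝 0] 0 := by
  have h := (contDiff_sq_div s).continuous.tendsto 0
  have h2 : ∀ᶠ w : ℂ in 𝓝 0, ‖w‖ ^ 2 / s ^ 2 < 1 / 2 :=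
    h.eventually (eventually_lt_nhds (by simp))
  filter_upwards [h2] with w hw
  simp [cutCauchy, smoothStep_of_le hw.le]

theorem contDiff_cutCauchy (s : ℝ) : ContDiff ℝ ∞ (cutCauchy s) := by
  rw [contDiff_iff_contDiffAt]
  intro w
  rcases eq_or_ne w 0 with rfl | hw
  · exact contDiffAt_const.congr_of_eventuallyEq (cutCauchy_eventuallyEq_zero s)
  · exact (Complex.ofRealCLM.contDiff.comp
      (contDiff_smoothStep.comp (contDiff_sq_div s))).contDiffAt.mul (contDiffAt_inv ℝ hw)

theorem contDiff_radialBump (s : ℝ) : ContDiff ℝ ∞ (radialBump s) :=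
  contDiff_const.mul (contDiff_deriv_smoothStep.comp (contDiff_sq_div s))

theorem cutCauchy_of_le {s : ℝ} (hs : 0 < s) {w : ℂ} (hw : s ≤ ‖w‖) : cutCauchy s w = w⁻¹ := by
  have : 1 ≤ ‖w‖ ^ 2 / s ^ 2 := by
    rw [le_div_iff₀ (by positivity), one_mul]
    gcongr
  rw [cutCauchy, smoothStep_of_ge this, Complex.ofReal_one, one_mul]

theorem support_radialBump_subset {s : ℝ} (hs : 0 < s) :
    Function.support (radialBump s) ⊆ Metric.closedBall 0 s := by
  intro w hw
  by_contra h
  rw [mem_closedBall_zero_iff, not_le] at h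
  refine hw ?_
  have : 1 < ‖w‖ ^ 2 / s ^ 2 := by
    rw [lt_div_iff₀ (by positivity), one_mul]
    gcongr
  rw [radialBump, deriv_smoothStep_of_gt this, mul_zero]

theorem hasCompactSupport_radialBump {s : ℝ} (hs : 0 < s) : HasCompactSupport (radialBump s) :=
  HasCompactSupport.of_support_subset_isCompact (isCompact_closedBall 0 s)
    (support_radialBump_subset hs)

theorem exists_radialBump_bound : ∃ C : ℝ, ∀ s > 0, ∀ w, |radialBump s w| ≤ C / s ^ 2 := by
  obtain ⟨C, hC⟩ := (isCompact_Icc (a := (0 : ℝ)) (b := 1)).exists_bound_of_continuousOn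
    contDiff_deriv_smoothStep.continuous.continuousOn
  have hC0 : 0 ≤ C := (norm_nonneg _).trans (hC 0 (by simp))
  refine ⟨2 * C, fun s hs w => ?_⟩
  have h : |deriv smoothStep (‖w‖ ^ 2 / s ^ 2)| ≤ C := by
    rcases le_or_gt (‖w‖ ^ 2 / s ^ 2) 1 with h | h
    · exact hC _ ⟨by positivity, h⟩
    · rw [deriv_smoothStep_of_gt h, abs_zero]
      exact hC0
  rw [radialBump, abs_mul, abs_of_pos (by positivity), mul_div_right_comm]
  gcongr

theorem integral_radialBump {s : ℝ} (hs : 0 < s) :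
    ∫ w, radialBump s w = ∫ w, radialBump 1 w := by
  have h := Measure.integral_comp_inv_smul_of_nonneg (volume : Measure ℂ) (radialBump 1) hs.le
  have e : ∀ w : ℂ, radialBump s w = (s ^ 2)⁻¹ * radialBump 1 (s⁻¹ • w) := by
    intro w
    simp only [radialBump, norm_smul, norm_inv, Real.norm_of_nonneg hs.le, mul_pow, inv_pow,
      one_pow, div_one]
    rw [div_eq_inv_mul, div_eq_inv_mul]
    ring
  simp only [e]
  rw [integral_const_mul, h, Complex.finrank_real_complex, smul_eq_mul,
    inv_mul_cancel_left₀ (by positivity)]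

theorem integral_radialBump_pos : 0 < ∫ w, radialBump 1 w := by
  obtain ⟨u, hu, h⟩ := exists_deriv_eq_slope smoothStep (a := 0) (b := 1) one_pos
    contDiff_smoothStep.continuous.continuousOn
    (contDiff_smoothStep.differentiable (by simp)).differentiableOn
  refine (contDiff_radialBump 1).continuous.integral_pos_of_hasCompactSupport_nonneg_nonzero
    (x := (Real.sqrt u : ℂ)) (hasCompactSupport_radialBump one_pos) (fun w => ?_) ?_
  · exact mul_nonneg (by norm_num) monotone_smoothStep.deriv_nonneg
  · simp [radialBump, Real.sq_sqrt hu.1.le, h, smoothStep_of_le, smoothStep_of_ge]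

theorem cauchyRiemann_cutCauchy (s : ℝ) (w : ℂ) :
    fderiv ℝ (cutCauchy s) w 1 + Complex.I * fderiv ℝ (cutCauchy s) w Complex.I =
      radialBump s w := by
  rcases eq_or_ne w 0 with rfl | hw
  · rw [(cutCauchy_eventuallyEq_zero s).fderiv_eq]
    simp [radialBump, deriv_smoothStep_of_lt]
  · have h1 : HasFDerivAt (fun w : ℂ => ‖w‖ ^ 2 / s ^ 2)
        ((s ^ 2)⁻¹ • (2 • innerSL ℝ w)) w := by
      simpa only [div_eq_inv_mul] using
        (hasStrictFDerivAt_norm_sq w).hasFDerivAt.const_mul ((s ^ 2)⁻¹)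
    have h2 := ((contDiff_smoothStep.differentiable (by simp)) (‖w‖ ^ 2 / s ^ 2)).hasDerivAt
    have h3 := (Complex.ofRealCLM.hasFDerivAt.comp w (h2.comp_hasFDerivAt w h1)).mul
      ((hasDerivAt_inv hw).hasFDerivAt.restrictScalars ℝ)
    have h4 : HasFDerivAt (cutCauchy s) _ w := h3
    rw [h4.fderiv]
    have hI := Complex.re_add_im w
    simp [radialBump]
    linear_combination (-((smoothStep (‖w‖ ^ 2 / s ^ 2) : ℝ) : ℂ) * (w ^ 2)⁻¹) * Complex.I_sq +
      (2 * ((deriv smoothStep (‖w‖ ^ 2 / s ^ 2) : ℝ) : ℂ) * ((s : ℂ) ^ 2)⁻¹) *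
        (w⁻¹ * hI + inv_mul_cancel₀ hw)

/-! ### Weyl's lemma for the Cauchy-Riemann operator -/

theorem lineDerivOp_apply {Ω : Opens ℂ} (φ : 𝓓(Ω, ℂ)) (v z : ℂ) :
    (∂_{v} φ : 𝓓(Ω, ℂ)) z = fderiv ℝ φ z v := by
  rw [TestFunction.lineDerivOp_eq_lineDerivCLM (𝕜 := ℝ), TestFunction.lineDerivCLM_apply_of_le le_top]
  exact ((φ.contDiff.differentiable (by simp)) z).lineDeriv_eq_fderiv

section Weyl

variable {Ω : Opens ℂ} {f : ℂ → ℂ}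

theorem SatisfiesCRE.integral_eq_zero (hf : SatisfiesCRE Ω f) {ψ : ℂ → ℂ} (hψ : ContDiff ℝ ∞ ψ)
    {s : ℝ} (hs : Function.support ψ ⊆ Metric.closedBall 0 s) {z : ℂ}
    (hz : Metric.closedBall z s ⊆ Ω) :
    ∫ ζ in Ω, f ζ * (fderiv ℝ ψ (z - ζ) 1 + Complex.I * fderiv ℝ ψ (z - ζ) Complex.I) = 0 := by
  have hsupp : Function.support (fun ζ => ψ (z - ζ)) ⊆ Metric.closedBall z s := by
    intro ζ hζ
    have := hs hζ
    rwa [mem_closedBall_zero_iff, norm_sub_rev, ← mem_closedBall_iff_norm] at this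
  let φ : 𝓓(Ω, ℂ) := ⟨fun ζ => ψ (z - ζ), hψ.comp (contDiff_const.sub contDiff_id),
    HasCompactSupport.of_support_subset_isCompact (isCompact_closedBall z s) hsupp,
    (closure_minimal hsupp Metric.isClosed_closedBall).trans hz⟩
  have h := hf φ
  simp only [lineDerivOp_apply] at h
  have e : ∀ ζ v, fderiv ℝ φ ζ v = -fderiv ℝ ψ (z - ζ) v := by
    intro ζ v
    have h1 := ((hψ.differentiable (by simp)) (z - ζ)).hasFDerivAt.comp ζ
      ((hasFDerivAt_id ζ).const_sub z)
    have h2 : HasFDerivAt φ _ ζ := h1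
    rw [h2.fderiv]
    simp
  simp only [e] at h
  rw [← neg_eq_zero, ← integral_neg, ← h]
  exact integral_congr_ae (Eventually.of_forall fun ζ => by ring)

/-- The mean of `f` around `z` with respect to the radial mollifier at scale `s`. -/
def radialMean (Ω : Opens ℂ) (f : ℂ → ℂ) (s : ℝ) (z : ℂ) : ℂ :=
  (∫ w, radialBump 1 w : ℂ)⁻¹ * ∫ ζ in Ω, f ζ * radialBump s (z - ζ)

theorem radialBump_sub_eq_zero {s : ℝ} (hs : 0 < s) {z ζ : ℂ} (h : ζ ∉ Metric.closedBall z s) :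
    radialBump s (z - ζ) = 0 := by
  by_contra h0
  have := support_radialBump_subset hs h0
  rw [mem_closedBall_zero_iff, norm_sub_rev, ← mem_closedBall_iff_norm] at this
  exact h this

theorem integrableOn_mul_radialBump (hf : LocallyIntegrableOn f Ω) {s : ℝ} (hs : 0 < s) {z : ℂ}
    (hz : Metric.closedBall z s ⊆ Ω) : IntegrableOn (fun ζ => f ζ * radialBump s (z - ζ)) Ω := by
  have hc : Continuous fun ζ : ℂ => (radialBump s (z - ζ) : ℂ) :=
    Complex.continuous_ofReal.comp
      ((contDiff_radialBump s).continuous.comp (continuous_const.sub continuous_id))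
  have h := (hf.integrableOn_compact_subset hz (isCompact_closedBall z s)).mul_continuousOn
    hc.continuousOn (isCompact_closedBall z s)
  refine h.of_forall_sdiff_eq_zero Ω.isOpen.measurableSet fun ζ hζ => ?_
  simp [radialBump_sub_eq_zero hs hζ.2]

theorem radialMean_eq_integral {V : Set ℂ} (hVΩ : V ⊆ Ω) {s : ℝ} (hs : 0 < s)
    {z : ℂ} (hz : Metric.closedBall z s ⊆ V) :
    radialMean Ω f s z =
      (∫ w, radialBump 1 w : ℂ)⁻¹ * ∫ ζ, V.indicator f ζ * radialBump s (z - ζ) := by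
  rw [radialMean, setIntegral_eq_integral_of_forall_compl_eq_zero]
  · congr 1
    refine integral_congr_ae (Eventually.of_forall fun ζ => ?_)
    by_cases h : ζ ∈ V
    · simp [h]
    · simp [radialBump_sub_eq_zero hs fun h' => h (hz h')]
  · intro ζ hζ
    simp [radialBump_sub_eq_zero hs fun h' => hζ (hVΩ (hz h'))]

/-- The radial means of a solution of the Cauchy-Riemann equations do not depend on the scale. -/
theorem radialMean_eq (hf : LocallyIntegrableOn f Ω) (hcr : SatisfiesCRE Ω f) {s t : ℝ}
    (hs : 0 < s) (ht : 0 < t) {z : ℂ} (hzs : Metric.closedBall z s ⊆ Ω)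
    (hzt : Metric.closedBall z t ⊆ Ω) : radialMean Ω f s z = radialMean Ω f t z := by
  have hmax : Metric.closedBall z (max s t) ⊆ Ω := by
    rcases max_choice s t with h | h <;> rw [h] <;> assumption
  have hsupp : Function.support (cutCauchy s - cutCauchy t) ⊆ Metric.closedBall 0 (max s t) := by
    intro w hw
    by_contra h
    rw [mem_closedBall_zero_iff, not_le, max_lt_iff] at h
    refine hw ?_
    rw [Pi.sub_apply, cutCauchy_of_le hs h.1.le, cutCauchy_of_le ht h.2.le, sub_self]
  have h := hcr.integral_eq_zero ((contDiff_cutCauchy s).sub (contDiff_cutCauchy t)) hsupp hmax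
  have e : ∀ w, fderiv ℝ (fun x => cutCauchy s x - cutCauchy t x) w 1 +
      Complex.I * fderiv ℝ (fun x => cutCauchy s x - cutCauchy t x) w Complex.I =
        (radialBump s w : ℂ) - radialBump t w := by
    intro w
    rw [fderiv_fun_sub ((contDiff_cutCauchy s).differentiable (by simp) w)
      ((contDiff_cutCauchy t).differentiable (by simp) w), ← cauchyRiemann_cutCauchy,
      ← cauchyRiemann_cutCauchy]
    simp only [sub_apply]
    ring
  simp only [e, mul_sub] at h
  rw [integral_sub (integrableOn_mul_radialBump hf hs hzs)
    (integrableOn_mul_radialBump hf ht hzt), sub_eq_zero] at h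
  rw [radialMean, radialMean, h]

theorem differentiableAt_radialMean (hf : LocallyIntegrableOn f Ω) (hcr : SatisfiesCRE Ω f)
    {s : ℝ} (hs : 0 < s) {z : ℂ} (hz : Metric.closedBall z (2 * s) ⊆ Ω) :
    DifferentiableAt ℂ (radialMean Ω f s) z := by
  set L := Metric.closedBall z (2 * s)
  have hint : Integrable (L.indicator f) :=
    (hf.integrableOn_compact_subset hz (isCompact_closedBall _ _)).integrable_indicator
      Metric.isClosed_closedBall.measurableSet
  set η : ℂ → ℂ := fun w => radialBump s w with hη
  have hηd : ContDiff ℝ ∞ η := Complex.ofRealCLM.contDiff.comp (contDiff_radialBump s)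
  have hηs : Function.support η ⊆ Metric.closedBall 0 s := fun w hw =>
    support_radialBump_subset hs fun h => hw (by simp [hη, h])
  have hηc : HasCompactSupport η :=
    HasCompactSupport.of_support_subset_isCompact (isCompact_closedBall 0 s) hηs
  have hsub : Metric.closedBall z s ⊆ L := Metric.closedBall_subset_closedBall (by linarith)
  have key := hηc.hasFDerivAt_convolution_right (ContinuousLinearMap.mul ℝ ℂ)
    hint.locallyIntegrable (hηd.of_le (by simp)) z
  set B := convolution (L.indicator f) (fderiv ℝ η)
    (ContinuousLinearMap.precompR ℂ (ContinuousLinearMap.mul ℝ ℂ)) volume z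
  have hB : ∀ v, B v = ∫ ζ, L.indicator f ζ * fderiv ℝ η (z - ζ) v := by
    intro v
    rw [convolution_precompR_apply _ hint.locallyIntegrable (hηc.fderiv ℝ)
      (hηd.continuous_fderiv (by simp))]
    rfl
  have hBint : ∀ v, Integrable fun ζ => L.indicator f ζ * fderiv ℝ η (z - ζ) v := by
    intro v
    obtain ⟨C, hC⟩ := (hηc.fderiv ℝ).exists_bound_of_continuous (hηd.continuous_fderiv (by simp))
    have hcont : Continuous fun ζ => fderiv ℝ η (z - ζ) v :=
      ((hηd.continuous_fderiv (by simp)).comp (continuous_const.sub continuous_id)).clm_apply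
        continuous_const
    refine hint.mul_bdd (c := C * ‖v‖) hcont.aestronglyMeasurable
      (Eventually.of_forall fun ζ => ?_)
    exact (ContinuousLinearMap.le_opNorm _ _).trans
      (mul_le_mul_of_nonneg_right (hC _) (norm_nonneg _))
  have hCR : B 1 + Complex.I * B Complex.I = 0 := by
    rw [hB, hB, ← integral_const_mul, ← integral_add (hBint 1) ((hBint _).const_mul _),
      ← hcr.integral_eq_zero hηd hηs (hsub.trans hz),
      ← setIntegral_eq_integral_of_forall_compl_eq_zero (s := Ω)]
    · refine integral_congr_ae (Eventually.of_forall fun ζ => ?_)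
      by_cases h : ζ ∈ L
      · simp only [Set.indicator_of_mem h]
        ring
      · have h' : z - ζ ∉ tsupport (fderiv ℝ η) := by
          intro h'
          have := closure_minimal hηs Metric.isClosed_closedBall (tsupport_fderiv_subset ℝ h')
          rw [mem_closedBall_zero_iff, norm_sub_rev, ← mem_closedBall_iff_norm] at this
          exact h (hsub this)
        simp [h, image_eq_zero_of_notMem_tsupport h']
    · intro ζ hζ
      simp [Set.indicator_of_notMem fun h => hζ (hz h)]
  have hconv : DifferentiableAt ℂ
      (convolution (L.indicator f) η (ContinuousLinearMap.mul ℝ ℂ) volume) z := by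
    refine differentiableAt_complex_iff_differentiableAt_real.2 ⟨key.differentiableAt, ?_⟩
    rw [key.fderiv, smul_eq_mul]
    linear_combination (-Complex.I) * hCR + B Complex.I * Complex.I_sq
  refine (hconv.const_mul (∫ w, radialBump 1 w : ℂ)⁻¹).congr_of_eventuallyEq ?_
  filter_upwards [Metric.ball_mem_nhds z hs] with w hw
  refine radialMean_eq_integral hz hs fun u hu => ?_
  rw [Metric.mem_closedBall] at hu ⊢
  rw [Metric.mem_ball] at hw
  linarith [dist_triangle u w z]

theorem ae_tendsto_radialMean (hf : LocallyIntegrableOn f Ω) :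
    ∀ᵐ z ∂volume.restrict (Ω : Set ℂ),
      Tendsto (fun t => radialMean Ω f t z) (𝓝[>] 0) (𝓝 (f z)) := by
  rw [ae_restrict_iff' Ω.isOpen.measurableSet]
  obtain ⟨u, hu, hΩu, hint⟩ := hf.exists_nat_integrableOn
  have hV : ∀ n, IsOpen (u n ∩ Ω) := fun n => (hu n).inter Ω.isOpen
  have hint' : ∀ n, Integrable ((u n ∩ Ω).indicator f) := fun n =>
    (hint n).integrable_indicator (hV n).measurableSet
  obtain ⟨C, hC⟩ := exists_radialBump_bound
  set c := ∫ w, radialBump 1 w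
  have hc : 0 < c := integral_radialBump_pos
  have hae := ae_all_iff.2 fun n => IsUnifLocDoublingMeasure.ae_tendsto_average_norm_sub volume
    (hint' n).locallyIntegrable 1
  filter_upwards [hae] with z hz hzΩ
  obtain ⟨n, hn⟩ := Set.mem_iUnion.1 (hΩu hzΩ)
  have hzV : z ∈ u n ∩ Ω := ⟨hn, hzΩ⟩
  have hpos : ∀ᶠ t : ℝ in 𝓝[>] 0, 0 < t := self_mem_nhdsWithin
  have havg := hz n (fun _ : ℝ => z) id tendsto_id
    (hpos.mono fun t ht => by simp [ht.le])
  have key := tendsto_integral_smul_of_tendsto_average_norm_sub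
    (g := fun t ζ => c⁻¹ * radialBump t (z - ζ)) (c⁻¹ * C * Real.pi) havg
    (Eventually.of_forall fun t => (hint' n).integrableOn) ?_ ?_ ?_
  · rw [Set.indicator_of_mem hzV] at key
    refine key.congr' ?_
    obtain ⟨r, hr, hsub⟩ := Metric.nhds_basis_closedBall.mem_iff.1 ((hV n).mem_nhds hzV)
    filter_upwards [hpos, eventually_nhdsWithin_of_eventually_nhds (eventually_le_nhds hr)]
      with t ht htr
    rw [radialMean_eq_integral Set.inter_subset_right ht
      ((Metric.closedBall_subset_closedBall htr).trans hsub), integral_complex_ofReal,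
      ← integral_const_mul]
    refine integral_congr_ae (Eventually.of_forall fun ζ => ?_)
    simp only [Complex.real_smul, Complex.ofReal_mul, Complex.ofReal_inv]
    ring
  · refine tendsto_const_nhds.congr' (hpos.mono fun t ht => ?_)
    simp only
    rw [integral_const_mul, integral_sub_left_eq_self (radialBump t) volume z,
      integral_radialBump ht, inv_mul_cancel₀ hc.ne']
  · refine hpos.mono fun t ht ζ hζ => ?_
    by_contra h
    exact hζ (by simp [radialBump_sub_eq_zero ht h])
  · refine hpos.mono fun t ht ζ => ?_
    have hvol : volume.real (Metric.closedBall z (id t)) = Real.pi * t ^ 2 := by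
      rw [id, Measure.real, Complex.volume_closedBall, ENNReal.toReal_mul, ENNReal.toReal_pow,
        ENNReal.toReal_ofReal ht.le, mul_comm]
      rfl
    rw [hvol, abs_mul, abs_of_pos (inv_pos.2 hc)]
    calc c⁻¹ * |radialBump t (z - ζ)| ≤ c⁻¹ * (C / t ^ 2) := by
          gcongr
          exact hC t ht _
      _ = _ := by
          have := Real.pi_pos
          field_simp

/-- **Weyl's lemma** for the Cauchy-Riemann operator: locally integrable distributional solutions
are holomorphic functions. -/
theorem SatisfiesCRE.exists_differentiableOn (hf : LocallyIntegrableOn f Ω)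
    (hcr : SatisfiesCRE Ω f) :
    ∃ F : ℂ → ℂ, DifferentiableOn ℂ F Ω ∧ f =ᵐ[volume.restrict Ω] F := by
  have hex : ∀ z, ∃ r : ℝ, z ∈ Ω → 0 < r ∧ Metric.closedBall z (2 * r) ⊆ Ω := by
    intro z
    by_cases hz : z ∈ Ω
    · obtain ⟨r, hr, hsub⟩ := Metric.nhds_basis_closedBall.mem_iff.1 (Ω.isOpen.mem_nhds hz)
      exact ⟨r / 2, fun _ => ⟨by positivity, by rwa [mul_div_cancel₀ r two_ne_zero]⟩⟩
    · exact ⟨0, fun h => absurd h hz⟩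
  choose τ hτ using hex
  have hball : ∀ z ∈ Ω, Metric.closedBall z (τ z) ⊆ Ω := fun z hz =>
    (Metric.closedBall_subset_closedBall (by linarith [(hτ z hz).1])).trans (hτ z hz).2
  refine ⟨fun z => radialMean Ω f (τ z) z, fun z hz => ?_, ?_⟩
  · refine ((differentiableAt_radialMean hf hcr (hτ z hz).1
      (hτ z hz).2).congr_of_eventuallyEq ?_).differentiableWithinAt
    filter_upwards [Metric.ball_mem_nhds z (hτ z hz).1, Ω.isOpen.mem_nhds hz] with w hw hwΩ
    refine radialMean_eq hf hcr (hτ w hwΩ).1 (hτ z hz).1 (hball w hwΩ) fun u hu => (hτ z hz).2 ?_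
    rw [Metric.mem_closedBall] at hu ⊢
    rw [Metric.mem_ball] at hw
    linarith [dist_triangle u w z]
  · filter_upwards [ae_tendsto_radialMean hf, ae_restrict_mem Ω.isOpen.measurableSet] with z h hz
    refine tendsto_nhds_unique h (tendsto_const_nhds.congr' ?_)
    obtain ⟨r, hr, hsub⟩ := Metric.nhds_basis_closedBall.mem_iff.1 (Ω.isOpen.mem_nhds hz)
    filter_upwards [self_mem_nhdsWithin,
      eventually_nhdsWithin_of_eventually_nhds (eventually_le_nhds hr)] with t ht htr
    exact radialMean_eq hf hcr (hτ z hz).1 ht (hball z hz)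
      ((Metric.closedBall_subset_closedBall htr).trans hsub)

end Weyl

/-! ### Weak derivatives of holomorphic functions -/

section WeakDeriv

variable {Ω : Opens ℂ}

/-- The partial derivative of a holomorphic function in the direction `v`. -/
def dirDeriv (v : ℂ) (F : ℂ → ℂ) (z : ℂ) : ℂ := v * deriv F z

theorem differentiableOn_dirDeriv (v : ℂ) {F : ℂ → ℂ} (hF : DifferentiableOn ℂ F Ω) :
    DifferentiableOn ℂ (dirDeriv v F) Ω := (hF.deriv Ω.isOpen).const_mul v

theorem differentiableOn_iterate_dirDeriv (v : ℂ) {F : ℂ → ℂ} (hF : DifferentiableOn ℂ F Ω)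
    (n : ℕ) : DifferentiableOn ℂ ((dirDeriv v)^[n] F) Ω := by
  induction n with
  | zero => exact hF
  | succ n ih =>
    rw [Function.iterate_succ_apply']
    exact differentiableOn_dirDeriv v ih

theorem commute_dirDeriv (v w : ℂ) : Function.Commute (dirDeriv v) (dirDeriv w) := by
  intro F
  funext z
  have h : ∀ c : ℂ, deriv (dirDeriv c F) z = c * deriv (deriv F) z := fun c =>
    deriv_const_mul_field c
  rw [dirDeriv, dirDeriv, h, h]
  ring

theorem integrableOn_mul_testFunction {g : ℂ → ℂ} (hg : LocallyIntegrableOn g Ω) (φ : 𝓓(Ω, ℂ)) :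
    IntegrableOn (fun z => g z * φ z) Ω := by
  have h := (hg.integrableOn_compact_subset φ.tsupport_subset
    φ.hasCompactSupport.isCompact).mul_continuousOn φ.continuous.continuousOn
    φ.hasCompactSupport.isCompact
  exact h.of_forall_sdiff_eq_zero Ω.isOpen.measurableSet fun ζ hζ => by
    simp [image_eq_zero_of_notMem_tsupport hζ.2]

theorem setIntegral_mul_testFunction (g : ℂ → ℂ) (φ : 𝓓(Ω, ℂ)) :
    ∫ z in Ω, g z * φ z = ∫ z, g z * φ z :=
  setIntegral_eq_integral_of_forall_compl_eq_zero fun z hz => by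
    simp [image_eq_zero_of_notMem_tsupport fun h => hz (φ.tsupport_subset h)]

theorem integrable_mul_testFunction {g : ℂ → ℂ} (hg : LocallyIntegrableOn g Ω) (φ : 𝓓(Ω, ℂ)) :
    Integrable fun z => g z * φ z := by
  rw [← integrableOn_univ]
  refine (integrableOn_mul_testFunction hg φ).of_forall_sdiff_eq_zero MeasurableSet.univ
    fun z hz => ?_
  simp [image_eq_zero_of_notMem_tsupport fun h => hz.2 (φ.tsupport_subset h)]

theorem locallyIntegrableOn_of_differentiableOn {F : ℂ → ℂ} (hF : DifferentiableOn ℂ F Ω) :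
    LocallyIntegrableOn F Ω :=
  hF.continuousOn.locallyIntegrableOn Ω.isOpen.measurableSet

theorem integral_mul_lineDeriv {F : ℂ → ℂ} (hF : DifferentiableOn ℂ F Ω) (v : ℂ) (φ : 𝓓(Ω, ℂ)) :
    ∫ z in Ω, F z * (∂_{v} φ : 𝓓(Ω, ℂ)) z = -∫ z in Ω, dirDeriv v F z * φ z := by
  have hd : ∀ z, fderiv ℝ F z v • φ z = dirDeriv v F z * φ z := by
    intro z
    by_cases hz : z ∈ tsupport φ
    · have h := hF.differentiableAt (Ω.isOpen.mem_nhds (φ.tsupport_subset hz))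
      rw [(h.hasDerivAt.hasFDerivAt.restrictScalars ℝ).fderiv]
      simp [dirDeriv]
    · simp [image_eq_zero_of_notMem_tsupport hz]
  have key := integral_smul_fderiv_eq_neg_fderiv_smul_of_integrable (μ := volume) (f := F)
    (g := φ) (v := v) ?_ ?_ ?_ (fun z hz => ?_)
    fun z _ => (φ.contDiff.differentiable (by simp)) z
  · rw [setIntegral_mul_testFunction, setIntegral_mul_testFunction]
    simpa only [hd, smul_eq_mul, lineDerivOp_apply] using key
  · simp only [hd]
    exact integrable_mul_testFunction
      (locallyIntegrableOn_of_differentiableOn (differentiableOn_dirDeriv v hF)) φ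
  · simpa only [smul_eq_mul, lineDerivOp_apply] using
      integrable_mul_testFunction (locallyIntegrableOn_of_differentiableOn hF) (∂_{v} φ : 𝓓(Ω, ℂ))
  · exact integrable_mul_testFunction (locallyIntegrableOn_of_differentiableOn hF) φ
  · exact (hF.differentiableAt
      (Ω.isOpen.mem_nhds (φ.tsupport_subset hz))).restrictScalars ℝ

theorem integral_mul_iterate_lineDeriv {F : ℂ → ℂ} (hF : DifferentiableOn ℂ F Ω) (v : ℂ) (n : ℕ)
    (φ : 𝓓(Ω, ℂ)) :
    ∫ z in Ω, F z * ((fun ψ : 𝓓(Ω, ℂ) => ∂_{v} ψ)^[n] φ) z =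
      (-1) ^ n * ∫ z in Ω, (dirDeriv v)^[n] F z * φ z := by
  induction n generalizing φ with
  | zero => simp
  | succ n ih =>
    rw [Function.iterate_succ_apply, ih, Function.iterate_succ_apply',
      integral_mul_lineDeriv (differentiableOn_iterate_dirDeriv v hF n)]
    ring

theorem ae_eq_of_integral_mul_testFunction_eq {g G : ℂ → ℂ} (hg : LocallyIntegrableOn g Ω)
    (hG : LocallyIntegrableOn G Ω)
    (h : ∀ φ : 𝓓(Ω, ℂ), ∫ z in Ω, g z * φ z = ∫ z in Ω, G z * φ z) :
    g =ᵐ[volume.restrict Ω] G := by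
  have key := Ω.isOpen.ae_eq_zero_of_integral_contDiff_smul_eq_zero (μ := volume)
    (f := fun z => g z - G z) (hg.sub hG) fun ψ hψ hc hs => ?_
  · refine (ae_restrict_iff' Ω.isOpen.measurableSet).2 ?_
    exact key.mono fun z hz hzΩ => sub_eq_zero.1 (hz hzΩ)
  · have hsub : tsupport (fun z => (ψ z : ℂ)) ⊆ tsupport ψ :=
      closure_mono fun z hz h0 => hz (by simp [h0])
    let φ : 𝓓(Ω, ℂ) := ⟨fun z => (ψ z : ℂ), Complex.ofRealCLM.contDiff.comp hψ,
      hc.comp_left (g := fun x : ℝ => (x : ℂ)) Complex.ofReal_zero, hsub.trans hs⟩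
    have h1 := h φ
    rw [setIntegral_mul_testFunction, setIntegral_mul_testFunction, ← sub_eq_zero,
      ← integral_sub (integrable_mul_testFunction hg φ) (integrable_mul_testFunction hG φ)] at h1
    rw [← h1]
    refine integral_congr_ae (Eventually.of_forall fun z => ?_)
    change (ψ z : ℝ) • (g z - G z) = g z * (ψ z : ℂ) - G z * (ψ z : ℂ)
    rw [Complex.real_smul]
    ring

/-- Weak derivatives of a holomorphic function are its classical derivatives. -/
theorem IsWeakDeriv.ae_eq {a b : ℕ} {f g F : ℂ → ℂ} (h : IsWeakDeriv Ω a b f g)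
    (hg : LocallyIntegrableOn g Ω) (hF : DifferentiableOn ℂ F Ω)
    (hfF : f =ᵐ[volume.restrict Ω] F) :
    g =ᵐ[volume.restrict Ω] (dirDeriv 1)^[a] ((dirDeriv Complex.I)^[b] F) := by
  have hG := differentiableOn_iterate_dirDeriv 1
    (differentiableOn_iterate_dirDeriv Complex.I hF b) a
  refine ae_eq_of_integral_mul_testFunction_eq hg (locallyIntegrableOn_of_differentiableOn hG)
    fun φ => ?_
  have h1 := h φ
  rw [integral_congr_ae (g := fun z => F z * ((fun ψ : 𝓓(Ω, ℂ) => ∂_{(1 : ℂ)} ψ)^[a]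
      ((fun ψ : 𝓓(Ω, ℂ) => ∂_{Complex.I} ψ)^[b] φ)) z) (hfF.mono fun z hz => by simp only [hz]),
    integral_mul_iterate_lineDeriv hF, integral_mul_iterate_lineDeriv
      (differentiableOn_iterate_dirDeriv 1 hF a), ← mul_assoc, ← pow_add,
    (commute_dirDeriv Complex.I 1).iterate_iterate b a F] at h1
  exact (mul_left_cancel₀ (pow_ne_zero _ (by norm_num)) h1).symm

theorem subset_embDom_iterate {ρ : Gauge} (k : 𝓓(Ω, ℂ)) {F : ℂ → ℂ}
    (hF : DifferentiableOn ℂ F Ω) (v : ℂ) (n : ℕ) :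
    embDom ρ Ω k F ⊆ embDom ρ Ω k ((dirDeriv v)^[n] F) := by
  induction n with
  | zero => exact subset_rfl
  | succ n ih =>
    rw [Function.iterate_succ_apply']
    exact ih.trans
      (embDom_subset_embDom_deriv k (differentiableOn_iterate_dirDeriv v hF n) v)

theorem isIterPartialDeriv_emb (ρ : Gauge) (k : 𝓓(Ω, ℂ)) {F : ℂ → ℂ}
    (hF : DifferentiableOn ℂ F Ω) (a b : ℕ) :
    IsIterPartialDeriv ρ (embDom ρ Ω k F) a b (emb ρ Ω k F)
      (emb ρ Ω k ((dirDeriv 1)^[a] ((dirDeriv Complex.I)^[b] F))) := by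
  have hU := isSharplyOpen_embDom (ρ := ρ) (Ω := Ω) k F
  induction a with
  | zero =>
    induction b with
    | zero =>
      rw [IsIterPartialDeriv]
      exact fun z _ => rfl
    | succ b ih =>
      rw [IsIterPartialDeriv]
      refine ⟨_, ih, ?_⟩
      simp only [Function.iterate_zero, id, Function.iterate_succ_apply']
      exact isPartialDeriv_emb k (differentiableOn_iterate_dirDeriv _ hF b) Complex.norm_I hU
        (subset_embDom_iterate k hF _ b)
  | succ a ih =>
    have hb := differentiableOn_iterate_dirDeriv Complex.I hF b
    rw [IsIterPartialDeriv]
    refine ⟨_, ih, ?_⟩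
    rw [Function.iterate_succ_apply']
    exact isPartialDeriv_emb k (differentiableOn_iterate_dirDeriv _ hb a) norm_one hU
      ((subset_embDom_iterate k hF _ b).trans (subset_embDom_iterate k hb _ a))

end WeakDeriv

theorem eqOn_of_ae_eq {Ω : Opens ℂ} {f F : ℂ → ℂ} (hf : ContinuousOn f Ω) (hF : ContinuousOn F Ω)
    (h : f =ᵐ[volume.restrict Ω] F) : Set.EqOn f F Ω :=
  Measure.eqOn_open_of_ae_eq h Ω.isOpen hf hF

theorem nonempty_of_integral_eq_one {Ω : Opens ℂ} (k : 𝓓(Ω, ℂ)) (hk : ∫ z, k z = 1) :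
    (Ω : Set ℂ).Nonempty := by
  by_contra h
  rw [Set.not_nonempty_iff_eq_empty] at h
  have h0 : ∀ z, k z = 0 := fun z => image_eq_zero_of_notMem_tsupport fun hz => by
    have := k.tsupport_subset hz
    simp [h] at this
  simp [h0] at hk

/-- Near the standard points, the embedding is infinitely close to the given function. -/
theorem tendsto_of_isRep_emb {ρ : Gauge} {Ω : Opens ℂ} (k : 𝓓(Ω, ℂ)) (hk : ∫ z, k z = 1)
    {F : ℂ → ℂ} (hF : DifferentiableOn ℂ F Ω) {z : ℂ} (hz : z ∈ Ω) {x : Idx → ℂ}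
    (hx : IsRep ρ x (emb ρ Ω k F (std ρ z))) : Tendsto x small (𝓝 (F z)) :=
  (isRep_emb_std k hF hz).tendsto_congr hx (tendsto_conv ρ k hk hF.continuousOn hz)

end GHF
end

theorem mainTheorem6 (ρ : GHF.Gauge) (Ω : Opens ℂ) (k : 𝓓(Ω, ℂ)) (hk : ∫ z, k z = 1) :
    -- the embedding gives generalized holomorphic functions and preserves weak derivatives
    (∀ f : ℂ → ℂ, LocallyIntegrableOn f Ω → GHF.SatisfiesCRE Ω f →
      GHF.Defines ρ (GHF.embDom ρ Ω k f) (fun _ => (Ω : Set ℂ)) (GHF.conv ρ Ω k f)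
        (GHF.emb ρ Ω k f) ∧
      GHF.IsGHF ρ (GHF.embDom ρ Ω k f) (GHF.emb ρ Ω k f) ∧
      (∀ z ∈ Ω, GHF.std ρ z ∈ GHF.embDom ρ Ω k f) ∧
      ∀ (a b : ℕ) (g : ℂ → ℂ), LocallyIntegrableOn g Ω → GHF.IsWeakDeriv Ω a b f g →
        GHF.embDom ρ Ω k f ⊆ GHF.embDom ρ Ω k g ∧
        GHF.IsIterPartialDeriv ρ (GHF.embDom ρ Ω k f) a b (GHF.emb ρ Ω k f)
          (GHF.emb ρ Ω k g)) ∧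
    -- injectivity, functions on `Ω` being identified when they agree almost everywhere
    (∀ f g : ℂ → ℂ, LocallyIntegrableOn f Ω → GHF.SatisfiesCRE Ω f →
      LocallyIntegrableOn g Ω → GHF.SatisfiesCRE Ω g →
      ((GHF.embDom ρ Ω k f = GHF.embDom ρ Ω k g ∧
          Set.EqOn (GHF.emb ρ Ω k f) (GHF.emb ρ Ω k g) (GHF.embDom ρ Ω k f)) ↔
        f =ᵐ[volume.restrict Ω] g)) ∧
    -- continuous functions
    (∀ f : ℂ → ℂ, ContinuousOn f Ω → GHF.SatisfiesCRE Ω f →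
      DifferentiableOn ℂ f Ω ∧
      (∀ z ∈ Ω, GHF.HasStdPart ρ (GHF.emb ρ Ω k f (GHF.std ρ z)) (f z)) ∧
      ((∀ z ∈ Ω, ∃ c : ℂ, GHF.emb ρ Ω k f (GHF.std ρ z) = GHF.std ρ c) →
        ∀ z ∈ Ω, GHF.emb ρ Ω k f (GHF.std ρ z) = GHF.std ρ (f z))) := by
  refine ⟨fun f hf hcr => ?_, fun f g hf hfcr hg hgcr => ⟨fun h => ?_, fun h => ?_⟩,
    fun f hf hcr => ?_⟩
  · obtain ⟨F, hF, hfF⟩ := hcr.exists_differentiableOn hf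
    refine ⟨GHF.defines_emb k f, ?_⟩
    rw [GHF.embDom_congr k hfF, GHF.emb_congr k hfF]
    refine ⟨GHF.isGHF_emb k hF (GHF.nonempty_of_integral_eq_one k hk),
      fun z hz => GHF.std_mem_embDom k hF hz, fun a b g hg hw => ?_⟩
    have hgG := hw.ae_eq hg hF hfF
    rw [GHF.embDom_congr k hgG, GHF.emb_congr k hgG]
    exact ⟨(GHF.subset_embDom_iterate k hF _ b).trans
      (GHF.subset_embDom_iterate k (GHF.differentiableOn_iterate_dirDeriv _ hF b) _ a),
      GHF.isIterPartialDeriv_emb ρ k hF a b⟩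
  · obtain ⟨F, hF, hfF⟩ := hfcr.exists_differentiableOn hf
    obtain ⟨G, hG, hgG⟩ := hgcr.exists_differentiableOn hg
    rw [GHF.embDom_congr k hfF, GHF.emb_congr k hfF, GHF.emb_congr k hgG] at h
    have hFG : Set.EqOn F G Ω := fun z hz => by
      have hx := GHF.isRep_emb_std (ρ := ρ) k hG hz
      have hx' := hx
      rw [← h.2 (GHF.std_mem_embDom k hF hz)] at hx'
      exact tendsto_nhds_unique (GHF.tendsto_of_isRep_emb k hk hF hz hx')
        (GHF.tendsto_of_isRep_emb k hk hG hz hx)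
    filter_upwards [hfF, hgG, ae_restrict_mem Ω.isOpen.measurableSet] with z h1 h2 hz
    rw [h1, h2, hFG hz]
  · rw [GHF.embDom_congr k h, GHF.emb_congr k h]
    exact ⟨rfl, fun z _ => rfl⟩
  · obtain ⟨F, hF, hfF⟩ := hcr.exists_differentiableOn
      (hf.locallyIntegrableOn Ω.isOpen.measurableSet)
    have hd : DifferentiableOn ℂ f Ω :=
      hF.congr (GHF.eqOn_of_ae_eq hf hF.continuousOn hfF)
    refine ⟨hd, fun z hz => ?_, fun h z hz => ?_⟩
    · exact ⟨_, GHF.isRep_emb_std k hd hz, GHF.tendsto_conv ρ k hk hf hz⟩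
    · obtain ⟨c, hc⟩ := h z hz
      have hx : GHF.IsRep ρ (fun _ => c) (GHF.emb ρ Ω k f (GHF.std ρ z)) := hc ▸ GHF.isRep_std c
      rw [hc, tendsto_nhds_unique tendsto_const_nhds (GHF.tendsto_of_isRep_emb k hk hd hz hx)]
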